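/- Let $N$ be a free abelian group of finite rank $n$, $M=\mathrm{Hom}_{\mathbb Z}(N,\mathbb Z)$, $M_{\mathbb C}=M\otimes\mathbb C$, and let $\sigma\subset N_{\mathbb R}=N\otimes\mathbb R$ be a full-dimensional strongly convex rational polyhedral cone. Choose a rational linear functional $l$ with $l\ge 0$ on $\sigma$ and $\{l=0\}\cap\sigma=\{0\}$, put $P=\sigma\cap\{l=1\}$, and for each nonzero face $\mu$ of $\sigma$ choose a rational point $\rho_\mu\in P$ in the relative interior of $\mu$. Let $\mathcal C_Y$ be the simplicial complex whose maximal simplices have vertex sets $\{\rho_{\mu_1},\dots,\rho_{\mu_n}\}$ for the chains $\mu_1\subset\dots\subset\mu_n=\sigma$ of faces of $\sigma$ with $\dim\mu_i=i$ (the barycentric subdivision of $\sigma$); its simplices are the faces of these, including the empty one, written $0$. For a simplex $\gamma$ of $\mathcal C_Y$ with vertices $v_1,\dots,v_r$ (so $\dim\gamma=r-1$) and an integer $p\ge 0$ let $$V_\gamma^p=\Big(\bigwedge^{p-r}\gamma^\perp\Big)\otimes\frac{M_{\mathbb C}}{v_1^\perp}\otimes\dots\otimes\frac{M_{\mathbb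 C}}{v_r^\perp},$$ where $\perp$ denotes the annihilator in $M_{\mathbb C}$ and $\bigwedge^{k}=0$ for $k<0$; in particular $V_0^p=\bigwedge^pM_{\mathbb C}$. Consider the complex of vector spaces $$0\to V_0^p\to\bigoplus_{\substack{\gamma\in\mathcal C_Y\\ \dim\gamma=0}}V_\gamma^p\to\bigoplus_{\substack{\gamma\in\mathcal C_Y\\ \dim\gamma=1}}V_\gamma^p\to\dots\to\bigoplus_{\substack{\gamma\in\mathcal C_Y\\ \dim\gamma=p-1}}V_\gamma^p\to 0$$ with $V_0^p$ in cohomological degree $0$ (the degree-$0$ part of the pushforward, along the barycentric resolution $\pi\colon Y\to X_\sigma$, of the Ishida complex resolving the reflexive differentials $\Omega_Y^{[p]}$). The component $V_\gamma^p\to V_{\gamma'}^p$ of its differential is zero unless $\gamma$ is a facet of $\gamma'$; if $\gamma'$ has exactly one further vertex $v$, it is the map $$\bigwedge^{p-r}\gamma^\perp\to\bigwedge^{p-r-1}\gamma'^\perp\otimes\frac{\gamma^\perp}{\gamma'^\perp}\cong\bigwedge^{p-r-1}\gamma'^\perp\otimes\frac{M_{\mathbb C}}{v^\perp},\qquad w\wedge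 w_2\wedge\dots\wedge w_{p-r}\mapsto (w_2\wedge\dots\wedge w_{p-r})\otimes[w]$$ for $w\in\gamma^\perp$ and $w_2,\dots,w_{p-r}\in\gamma'^\perp$ (and zero on $\bigwedge^{p-r}\gamma'^\perp$), tensored with the identity of the other factors $M_{\mathbb C}/v_j^\perp$, where tensor products of these lines over a set of vertices are taken without ordering the vertices. Then, for every $p\ge 0$, this complex is exact in every cohomological degree other than $p$. -/

import Mathlib

open scoped TensorProduct

noncomputable section

namespace ToricIshida

variable (N : Type*) [AddCommGroup N]

/-- `N_ℝ = N ⊗ ℝ`. -/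
abbrev NR : Type _ := ℝ ⊗[ℤ] N

/-- `M_ℂ = M ⊗ ℂ`, where `M = Hom_ℤ(N, ℤ)` is the dual lattice. -/
def MC : Type _ := ℂ ⊗[ℤ] Module.Dual ℤ N

instance : AddCommGroup (MC N) := inferInstanceAs (AddCommGroup (ℂ ⊗[ℤ] Module.Dual ℤ N))

instance : Module ℂ (MC N) := inferInstanceAs (Module ℂ (ℂ ⊗[ℤ] Module.Dual ℤ N))

/-- `N_ℚ`, the rational points of `N_ℝ`. -/
def rationalPoints : Submodule ℚ (NR N) :=
  Submodule.span ℚ (Set.range fun x : N => (1 : ℝ) ⊗ₜ[ℤ] x)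

/-- `M_ℚ`, the rational linear functionals inside `M_ℝ = Hom_ℝ(N_ℝ, ℝ)`. -/
def rationalFunctionals : Submodule ℚ (Module.Dual ℝ (NR N)) :=
  Submodule.span ℚ (Set.range fun m : Module.Dual ℤ N => m.baseChange ℝ)

variable {N}

/-- A rational polyhedral cone: the cone generated by finitely many lattice points. -/
def IsRationalPolyhedral (σ : PointedCone ℝ (NR N)) : Prop :=
  ∃ S : Finset N, σ = PointedCone.hull ℝ ((fun x : N => (1 : ℝ) ⊗ₜ[ℤ] x) '' (S : Set N))

/-- The dimension of a cone: the dimension of the subspace it spans. -/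
def coneDim (μ : PointedCone ℝ (NR N)) : ℕ :=
  Module.finrank ℝ (Submodule.span ℝ (μ : Set (NR N)))

/-- The relative interior of a subset of `N_ℝ` (its interior inside its affine span), for the
canonical topology of the finite-dimensional real vector space `N_ℝ`. -/
def relativeInterior (S : Set (NR N)) : Set (NR N) :=
  letI : TopologicalSpace (NR N) := moduleTopology ℝ (NR N)
  intrinsicInterior ℝ S

/-- The choices that determine a barycentric subdivision of the cone `σ`: a rational functional `l`
that is nonnegative on `σ` and vanishes on `σ` only at `0`, which cuts out the polytope
`P = σ ∩ {l = 1}`, and a rational point `ρ μ` of `P` in the relative interior of each nonzero face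
`μ` of `σ`. (The values of `ρ` at other cones are never used.) -/
structure BarycentricChoice (σ : PointedCone ℝ (NR N)) where
  l : Module.Dual ℝ (NR N)
  l_rational : l ∈ rationalFunctionals N
  l_nonneg : ∀ x ∈ σ, 0 ≤ l x
  l_eq_zero : ∀ x ∈ σ, l x = 0 → x = 0
  ρ : PointedCone ℝ (NR N) → NR N
  ρ_rational : ∀ μ : PointedCone ℝ (NR N), μ.IsFaceOf σ → μ ≠ ⊥ → ρ μ ∈ rationalPoints N
  ρ_mem_polytope : ∀ μ : PointedCone ℝ (NR N), μ.IsFaceOf σ → μ ≠ ⊥ → ρ μ ∈ σ ∧ l (ρ μ) = 1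
  ρ_mem_interior : ∀ μ : PointedCone ℝ (NR N), μ.IsFaceOf σ → μ ≠ ⊥ →
    ρ μ ∈ relativeInterior (μ : Set (NR N))

/-- A complete flag `μ₁ ⊂ μ₂ ⊂ ⋯ ⊂ μₙ` of faces of `σ`, with `dim μᵢ = i` and `n = rank N`
(indexed from `0`). If `σ` is full-dimensional, then `μₙ = σ`. -/
structure IsFlag (σ : PointedCone ℝ (NR N))
    (μ : Fin (Module.finrank ℤ N) → PointedCone ℝ (NR N)) : Prop where
  isFaceOf : ∀ i, (μ i).IsFaceOf σ
  dim_eq : ∀ i, coneDim (μ i) = (i : ℕ) + 1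
  mono : Monotone μ

/-- The simplicial complex `C_Y` of the barycentric subdivision. A simplex is represented by its
finite set of vertices `γ` (the simplex is the convex hull of `γ`, and the corresponding cone of
the fan `Σ_Y` is the cone generated by `γ`). The maximal simplices are
`{ρ_{μ₁}, …, ρ_{μₙ}}` for the complete flags of faces of `σ`, and the simplices are the faces of
those. The empty simplex is included: it corresponds to the zero cone of `Σ_Y`. -/
def simplices {σ : PointedCone ℝ (NR N)} (B : BarycentricChoice σ) : Set (Finset (NR N)) :=
  {γ | ∃ μ : Fin (Module.finrank ℤ N) → PointedCone ℝ (NR N), IsFlag σ μ ∧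
    (γ : Set (NR N)) ⊆ Set.range fun i => B.ρ (μ i)}

/-- The `ℂ`-linear form `u ↦ u(v)` on `M_ℂ` given by a vector `v` of `N_ℝ`. -/
def eval (v : NR N) : Module.Dual ℂ (MC N) :=
  show ℂ ⊗[ℤ] Module.Dual ℤ N →ₗ[ℂ] ℂ from LinearMap.liftBaseChange ℂ
    { toFun := fun m : Module.Dual ℤ N => ((m.baseChange ℝ v : ℝ) : ℂ)
      map_add' := fun m m' => by simp
      map_smul' := fun k m => by simp }

theorem eval_tmul (v : NR N) (z : ℂ) (m : Module.Dual ℤ N) :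
    eval v (show MC N from z ⊗ₜ[ℤ] m) = z * ((m.baseChange ℝ v : ℝ) : ℂ) :=
  LinearMap.liftBaseChange_tmul ..

/-- `γ^⊥ ⊆ M_ℂ`, the functionals that vanish on `γ` (equivalently, on the cone generated by
`γ`). -/
def perp (γ : Finset (NR N)) : Submodule ℂ (MC N) :=
  ⨅ v ∈ γ, LinearMap.ker (eval v)

theorem mem_perp {γ : Finset (NR N)} {u : MC N} : u ∈ perp γ ↔ ∀ v ∈ γ, eval v u = 0 := by
  simp [perp]

/-- The line `M_ℂ / ρ^⊥` attached to the ray `ρ` through `v`. -/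
abbrev rayLine (v : NR N) : Type _ := MC N ⧸ perp {v}

/-- The class in `M_ℂ / ρ^⊥` of the functionals that take the value `1` at `v`. -/
def rayGen (v : NR N) : rayLine v :=
  open Classical in
  if h : ∃ e : MC N, eval v e = 1 then (perp {v}).mkQ h.choose else 0

/-- `rayGen v` does not depend on choices: the class of `u` is `u(v)` times `rayGen v`. -/
theorem mkQ_eq_smul_rayGen (v : NR N) (u : MC N) :
    (perp {v}).mkQ u = eval v u • rayGen v := by
  classical
  by_cases h : ∃ e : MC N, eval v e = 1
  · rw [rayGen, dif_pos h, ← map_smul, ← sub_eq_zero, ← map_sub]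
    have := h.choose_spec
    rw [Submodule.mkQ_apply, Submodule.Quotient.mk_eq_zero]
    simp [mem_perp, this]
  · have h0 : eval v u = 0 := by
      by_contra hu
      exact h ⟨(eval v u)⁻¹ • u, by simp [hu]⟩
    rw [h0, zero_smul, Submodule.mkQ_apply, Submodule.Quotient.mk_eq_zero]
    simp [mem_perp, h0]

/-- `⋀^{p-r} γ^⊥`, where `r` is the number of vertices of `γ`, as a subspace of the exterior
algebra of `M_ℂ` (through the injection `⋀ γ^⊥ → ⋀ M_ℂ`); it is zero if `r > p`. -/
def extPerp (p : ℕ) (γ : Finset (NR N)) : Submodule ℂ (ExteriorAlgebra ℂ (MC N)) :=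
  if γ.card ≤ p then
    (⋀[ℂ]^(p - γ.card) (perp γ)).map (ExteriorAlgebra.map (perp γ).subtype).toLinearMap
  else ⊥

/-- `M_ℂ/ρ₁^⊥ ⊗ ⋯ ⊗ M_ℂ/ρᵣ^⊥`, where `ρ₁, …, ρᵣ` are the rays through the vertices of `γ`. -/
def lineProduct (γ : Finset (NR N)) : Type _ := ⨂[ℂ] v : γ, rayLine (v : NR N)

instance (γ : Finset (NR N)) : AddCommGroup (lineProduct γ) :=
  inferInstanceAs (AddCommGroup (⨂[ℂ] v : γ, rayLine (v : NR N)))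

instance (γ : Finset (NR N)) : Module ℂ (lineProduct γ) :=
  (inferInstance : Module ℂ (⨂[ℂ] v : γ, rayLine (v : NR N)))

/-- The pure tensor `⨂ y_v` in `lineProduct γ`. -/
def pureTensor {γ : Finset (NR N)} (y : (v : γ) → rayLine (v : NR N)) : lineProduct γ :=
  PiTensorProduct.tprod ℂ y

theorem lineProduct_ext {γ : Finset (NR N)} {E : Type*} [AddCommGroup E] [Module ℂ E]
    {f g : lineProduct γ →ₗ[ℂ] E} (h : ∀ y : (v : γ) → rayLine (v : NR N),
      f (pureTensor y) = g (pureTensor y)) : f = g := by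
  have key : ∀ f' g' : (⨂[ℂ] v : γ, rayLine (v : NR N)) →ₗ[ℂ] E,
      (∀ y, f' (PiTensorProduct.tprod ℂ y) = g' (PiTensorProduct.tprod ℂ y)) → f' = g' :=
    fun f' g' h' => PiTensorProduct.ext (MultilinearMap.ext h')
  exact key f g h

/-- The vector space `V_γ^p = ⋀^{p-r} γ^⊥ ⊗ M_ℂ/ρ₁^⊥ ⊗ ⋯ ⊗ M_ℂ/ρᵣ^⊥`, where `ρ₁, …, ρᵣ` are the
rays through the vertices of `γ`. -/
def V (p : ℕ) (γ : Finset (NR N)) : Type _ :=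
  extPerp p γ ⊗[ℂ] lineProduct γ

instance (p : ℕ) (γ : Finset (NR N)) : AddCommGroup (V p γ) :=
  (inferInstance : AddCommGroup (extPerp p γ ⊗[ℂ] lineProduct γ))

instance (p : ℕ) (γ : Finset (NR N)) : Module ℂ (V p γ) :=
  (inferInstance : Module ℂ (extPerp p γ ⊗[ℂ] lineProduct γ))

/-- The pure tensor `x ⊗ t` in `V_γ^p`. -/
def V.tmul {p : ℕ} {γ : Finset (NR N)} (x : extPerp p γ) (t : lineProduct γ) : V p γ :=
  x ⊗ₜ[ℂ] t

/-- Contraction with `v` on the exterior algebra of `M_ℂ`: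
`w₁ ∧ ⋯ ∧ w_k ↦ ∑ᵢ (-1)^(i-1) wᵢ(v) w₁ ∧ ⋯ ŵᵢ ⋯ ∧ w_k`. -/
def contract (v : NR N) : ExteriorAlgebra ℂ (MC N) →ₗ[ℂ] ExteriorAlgebra ℂ (MC N) :=
  CliffordAlgebra.contractLeft (Q := (0 : QuadraticForm ℂ (MC N))) (eval v)

theorem contract_ι_mul (v : NR N) (a : MC N) (b : ExteriorAlgebra ℂ (MC N)) :
    contract v (ExteriorAlgebra.ι ℂ a * b) =
      eval v a • b - ExteriorAlgebra.ι ℂ a * contract v b :=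
  CliffordAlgebra.contractLeft_ι_mul (Q := (0 : QuadraticForm ℂ (MC N))) (d := eval v) a b

theorem contract_comm (v w : NR N) (x : ExteriorAlgebra ℂ (MC N)) :
    contract v (contract w x) = -contract w (contract v x) :=
  CliffordAlgebra.contractLeft_comm (Q := (0 : QuadraticForm ℂ (MC N))) (d := eval v) (eval w) x

theorem extPerp_of_le {p : ℕ} {γ : Finset (NR N)} (h : γ.card ≤ p) :
    extPerp p γ = ((perp γ).map (ExteriorAlgebra.ι ℂ)) ^ (p - γ.card) := by
  rw [extPerp, if_pos h, ExteriorAlgebra.exteriorPower, Submodule.map_pow]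
  congr 1
  rw [← LinearMap.range_comp]
  have : (ExteriorAlgebra.map (perp γ).subtype).toLinearMap ∘ₗ ExteriorAlgebra.ι ℂ =
      ExteriorAlgebra.ι ℂ ∘ₗ (perp γ).subtype := by
    ext x; simp
  rw [this, LinearMap.range_comp, Submodule.range_subtype]

theorem contract_pow_perp {γ : Finset (NR N)} {v : NR N} (hv : v ∈ γ) (k : ℕ) :
    ∀ x ∈ ((perp γ).map (ExteriorAlgebra.ι ℂ)) ^ k, contract v x = 0 := by
  induction k with
  | zero =>
    intro x hx
    rw [pow_zero, Submodule.mem_one] at hx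
    obtain ⟨c, rfl⟩ := hx
    exact CliffordAlgebra.contractLeft_algebraMap (0 : QuadraticForm ℂ (MC N)) (eval v) c
  | succ k ih =>
    intro x hx
    rw [pow_succ'] at hx
    induction hx using Submodule.mul_induction_on' with
    | mem_mul_mem a ha b hb =>
      obtain ⟨a, ha, rfl⟩ := ha
      rw [contract_ι_mul, ih b hb, mem_perp.1 ha v hv]
      simp
    | add a _ b _ ha hb => rw [map_add, ha, hb, add_zero]

open Classical in
/-- If `w₁, …, w_{k+1}` vanish on `γ \ {v}`, then contraction with `v` sends `w₁ ∧ ⋯ ∧ w_{k+1}` to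
`⋀^k γ^⊥`. -/
theorem contract_mem_pow {γ : Finset (NR N)} {v : NR N} (hv : v ∈ γ) (k : ℕ) :
    ∀ x ∈ ((perp (γ.erase v)).map (ExteriorAlgebra.ι ℂ)) ^ (k + 1),
      contract v x ∈ ((perp γ).map (ExteriorAlgebra.ι ℂ)) ^ k := by
  by_cases h : ∃ e ∈ perp (γ.erase v), eval v e = 1
  · obtain ⟨e, he, he1⟩ := h
    set K := (perp γ).map (ExteriorAlgebra.ι ℂ) with hK
    have key : ∀ k : ℕ, ∀ x ∈ ((perp (γ.erase v)).map (ExteriorAlgebra.ι ℂ)) ^ (k + 1),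
        ∃ a ∈ K ^ (k + 1), ∃ b ∈ K ^ k, x = a + ExteriorAlgebra.ι ℂ e * b := by
      have split : ∀ w ∈ perp (γ.erase v), ∃ a ∈ perp γ, ∃ c : ℂ, w = a + c • e := by
        intro w hw
        refine ⟨w - eval v w • e, ?_, eval v w, by simp⟩
        rw [mem_perp]
        intro u hu
        by_cases huv : u = v
        · subst huv; simp [he1]
        · have hu' : u ∈ γ.erase v := Finset.mem_erase.2 ⟨huv, hu⟩
          simp [mem_perp.1 hw u hu', mem_perp.1 he u hu']
      intro k
      induction k with
      | zero =>
        intro x hx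
        rw [zero_add, pow_one] at hx
        obtain ⟨w, hw, rfl⟩ := hx
        obtain ⟨a, ha, c, rfl⟩ := split w hw
        refine ⟨ExteriorAlgebra.ι ℂ a, by rw [zero_add, pow_one]; exact ⟨a, ha, rfl⟩,
          algebraMap ℂ _ c, by rw [pow_zero, Submodule.mem_one]; exact ⟨c, rfl⟩, ?_⟩
        rw [map_add, map_smul, ← Algebra.commutes, Algebra.smul_def]
      | succ k ih =>
        intro x hx
        rw [pow_succ'] at hx
        induction hx using Submodule.mul_induction_on' with
        | mem_mul_mem w hw y hy =>
          obtain ⟨w, hw, rfl⟩ := hw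
          obtain ⟨a, ha, c, rfl⟩ := split w hw
          obtain ⟨y₁, h₁, y₂, h₂, rfl⟩ := ih y hy
          have hιa : ExteriorAlgebra.ι ℂ a ∈ K := ⟨a, ha, rfl⟩
          refine ⟨ExteriorAlgebra.ι ℂ a * y₁, ?_, c • y₁ - ExteriorAlgebra.ι ℂ a * y₂, ?_, ?_⟩
          · rw [pow_succ' K (k + 1)]
            exact Submodule.mul_mem_mul hιa h₁
          · refine Submodule.sub_mem _ (Submodule.smul_mem _ _ h₁) ?_
            rw [pow_succ']
            exact Submodule.mul_mem_mul hιa h₂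
          · have e2 : ExteriorAlgebra.ι ℂ e * (ExteriorAlgebra.ι ℂ e * y₂) = 0 := by
              rw [← mul_assoc, ExteriorAlgebra.ι_sq_zero, zero_mul]
            have ea : ExteriorAlgebra.ι ℂ a * (ExteriorAlgebra.ι ℂ e * y₂) =
                -(ExteriorAlgebra.ι ℂ e * (ExteriorAlgebra.ι ℂ a * y₂)) := by
              rw [← mul_assoc, ← mul_assoc, ← neg_mul,
                eq_neg_of_add_eq_zero_left (ExteriorAlgebra.ι_add_mul_swap a e)]
            rw [map_add, map_smul, add_mul, mul_add, mul_add, ea, smul_mul_assoc,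
              smul_mul_assoc, e2, mul_sub, mul_smul_comm, smul_zero]
            abel
        | add x _ y _ hx hy =>
          obtain ⟨a, ha, b, hb, rfl⟩ := hx
          obtain ⟨a', ha', b', hb', rfl⟩ := hy
          refine ⟨a + a', add_mem ha ha', b + b', add_mem hb hb', ?_⟩
          rw [mul_add]; abel
    intro x hx
    obtain ⟨a, ha, b, hb, rfl⟩ := key k x hx
    rw [map_add, contract_pow_perp hv _ a ha, contract_ι_mul, contract_pow_perp hv _ b hb, he1]
    simpa using hb
  · intro x hx
    have hle : perp (γ.erase v) ≤ perp γ := by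
      intro w hw
      rw [mem_perp]
      intro u hu
      by_cases huv : u = v
      · subst huv
        by_contra h0
        exact h ⟨(eval u w)⁻¹ • w, Submodule.smul_mem _ _ hw, by simp [h0]⟩
      · exact mem_perp.1 hw u (Finset.mem_erase.2 ⟨huv, hu⟩)
    rw [contract_pow_perp hv (k + 1) x (pow_le_pow_left' (Submodule.map_mono hle) _ hx)]
    exact zero_mem _

open Classical in
theorem contract_mem_extPerp {p : ℕ} {μ ν : Finset (NR N)} {v : NR N} (hv : v ∈ ν)
    (h : μ = ν.erase v) (hp : ν.card ≤ p) :
    ∀ x ∈ extPerp p μ, contract v x ∈ extPerp p ν := by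
  subst h
  intro x hx
  have hc := Finset.card_erase_add_one hv
  rw [extPerp_of_le (by omega)] at hx
  rw [extPerp_of_le hp]
  rw [show p - (ν.erase v).card = p - ν.card + 1 by omega] at hx
  exact contract_mem_pow hv _ x hx

open Classical in
/-- The natural map `⋀^{p-l} μ^⊥ → ⋀^{p-l-1} ν^⊥` for `μ = ν \ {v}`: contraction with `v`.
It is zero if `⋀^{p-l-1} ν^⊥` lies beyond the end of the complex. -/
def contractPerp (p : ℕ) {μ ν : Finset (NR N)} {v : NR N} (hv : v ∈ ν) (h : μ = ν.erase v) :
    extPerp p μ →ₗ[ℂ] extPerp p ν :=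
  if hp : ν.card ≤ p then (contract v).restrict (contract_mem_extPerp hv h hp) else 0

open Classical in
theorem contractPerp_contractPerp {p : ℕ} {γ μ μ' ν : Finset (NR N)} {v w : NR N}
    (hv : v ∈ ν) (hw : w ∈ ν) (hμ : μ = ν.erase v) (hμ' : μ' = ν.erase w)
    (hw' : w ∈ μ) (hv' : v ∈ μ') (hγ : γ = μ.erase w) (hγ' : γ = μ'.erase v) (x : extPerp p γ) :
    contractPerp p hv hμ (contractPerp p hw' hγ x) =
      -contractPerp p hw hμ' (contractPerp p hv' hγ' x) := by
  by_cases hp : ν.card ≤ p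
  · have h1 : μ.card ≤ p := by subst hμ; exact (Finset.card_erase_le).trans hp
    have h2 : μ'.card ≤ p := by subst hμ'; exact (Finset.card_erase_le).trans hp
    simp only [contractPerp, dif_pos hp, dif_pos h1, dif_pos h2]
    exact Subtype.ext (contract_comm v w _)
  · simp [contractPerp, dif_neg hp]

open Classical in
theorem dite_update {μ ν : Finset (NR N)} (h : μ ⊆ ν) [DecidableEq μ]
    (y : (v : μ) → rayLine (v : NR N)) (i : μ) (c : rayLine (i : NR N)) :
    (fun v : ν => if hv : (v : NR N) ∈ μ then Function.update y i c ⟨v, hv⟩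
        else rayGen (v : NR N)) =
      Function.update (fun v : ν => if hv : (v : NR N) ∈ μ then y ⟨v, hv⟩ else rayGen (v : NR N))
        ⟨i, h i.2⟩ c := by
  obtain ⟨i, hi⟩ := i
  funext ⟨v, hv⟩
  by_cases hvi : v = i
  · subst hvi
    simp [hi]
  · rw [Function.update_of_ne (by simpa [Subtype.ext_iff] using hvi)]
    by_cases hvμ : v ∈ μ
    · rw [dif_pos hvμ, dif_pos hvμ, Function.update_of_ne (by simpa [Subtype.ext_iff] using hvi)]
    · rw [dif_neg hvμ, dif_neg hvμ]

/-- For `μ ⊆ ν`, the map `⨂_{v ∈ μ} M_ℂ/v^⊥ → ⨂_{v ∈ ν} M_ℂ/v^⊥` that inserts the factor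
`rayGen v` for each `v ∈ ν \ μ`. -/
def insertGen {μ ν : Finset (NR N)} (h : μ ⊆ ν) :
    lineProduct μ →ₗ[ℂ] lineProduct ν :=
  open Classical in
  show (⨂[ℂ] v : μ, rayLine (v : NR N)) →ₗ[ℂ] (⨂[ℂ] v : ν, rayLine (v : NR N)) from
  PiTensorProduct.lift
    { toFun := fun y => PiTensorProduct.tprod ℂ fun v : ν =>
        if hv : (v : NR N) ∈ μ then y ⟨v, hv⟩ else rayGen (v : NR N)
      map_update_add' := fun y i a b => by
        simp only [dite_update h, MultilinearMap.map_update_add]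
      map_update_smul' := fun y i c a => by
        simp only [dite_update h, MultilinearMap.map_update_smul] }

open Classical in
theorem insertGen_pureTensor {μ ν : Finset (NR N)} (h : μ ⊆ ν)
    (y : (v : μ) → rayLine (v : NR N)) :
    insertGen h (pureTensor y) = pureTensor fun v : ν =>
      if hv : (v : NR N) ∈ μ then y ⟨v, hv⟩ else rayGen (v : NR N) :=
  PiTensorProduct.lift.tprod (R := ℂ) (s := fun v : μ => rayLine (v : NR N))
    (E := ⨂[ℂ] v : ν, rayLine (v : NR N)) y

theorem insertGen_insertGen {γ μ ν : Finset (NR N)} (h : γ ⊆ μ) (h' : μ ⊆ ν)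
    (t : lineProduct γ) :
    insertGen h' (insertGen h t) = insertGen (h.trans h') t := by
  classical
  suffices (insertGen h').comp (insertGen h) = insertGen (h.trans h') from
    LinearMap.congr_fun this t
  refine lineProduct_ext fun y => ?_
  change insertGen h' (insertGen h (pureTensor y)) = insertGen (h.trans h') (pureTensor y)
  rw [insertGen_pureTensor, insertGen_pureTensor, insertGen_pureTensor]
  congr 1
  funext v
  by_cases h1 : (v : NR N) ∈ μ
  · simp only [dif_pos h1]
  · have h2 : (v : NR N) ∉ γ := fun h2 => h1 (h h2)
    rw [dif_neg h1, dif_neg h2]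

open Classical in
/-- The component `V_μ^p → V_ν^p` of the differential, for `μ = ν \ {v}`:
`x ⊗ y ↦ (contraction of x with v) ⊗ (y with the factor rayGen v inserted)`. On
`x = w ∧ w₂ ∧ ⋯ ∧ w_k` with `w₂, …, w_k ∈ ν^⊥` this is
`x ⊗ y ↦ (w₂ ∧ ⋯ ∧ w_k) ⊗ (y with the class of w in M_ℂ/v^⊥ inserted)`, the map induced by
`0 → ν^⊥ → μ^⊥ → μ^⊥/ν^⊥ → 0` and `μ^⊥/ν^⊥ ≅ M_ℂ/v^⊥`. Contractions anticommute and the tensor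
product of lines is unordered, so that no further sign is needed. -/
def component (p : ℕ) {μ ν : Finset (NR N)} {v : NR N} (hv : v ∈ ν) (h : μ = ν.erase v) :
    V p μ →ₗ[ℂ] V p ν :=
  show extPerp p μ ⊗[ℂ] lineProduct μ →ₗ[ℂ] extPerp p ν ⊗[ℂ] lineProduct ν from
  TensorProduct.map (contractPerp p hv h) (insertGen (h ▸ Finset.erase_subset v ν))

open Classical in
theorem component_tmul {p : ℕ} {μ ν : Finset (NR N)} {v : NR N} (hv : v ∈ ν) (h : μ = ν.erase v)
    (x : extPerp p μ) (t : lineProduct μ) :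
    component p hv h (V.tmul x t) =
      V.tmul (contractPerp p hv h x) (insertGen (h ▸ Finset.erase_subset v ν) t) := by
  rfl

open Classical in
theorem component_component {p : ℕ} {γ μ μ' ν : Finset (NR N)} {v w : NR N}
    (hv : v ∈ ν) (hw : w ∈ ν) (hμ : μ = ν.erase v) (hμ' : μ' = ν.erase w)
    (hw' : w ∈ μ) (hv' : v ∈ μ') (hγ : γ = μ.erase w) (hγ' : γ = μ'.erase v) (x : V p γ) :
    component p hv hμ (component p hw' hγ x) =
      -component p hw hμ' (component p hv' hγ' x) := by
  suffices component p hv hμ ∘ₗ component p hw' hγ =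
      -(component p hw hμ' ∘ₗ component p hv' hγ') from LinearMap.congr_fun this x
  refine TensorProduct.ext' (M := extPerp p γ) (N := lineProduct γ) fun x t => ?_
  change component p hv hμ (component p hw' hγ (V.tmul x t)) =
    -component p hw hμ' (component p hv' hγ' (V.tmul x t))
  simp only [component_tmul, insertGen_insertGen]
  rw [contractPerp_contractPerp hv hw hμ hμ' hw' hv' hγ hγ']
  exact TensorProduct.neg_tmul _ _

variable {σ : PointedCone ℝ (NR N)}

open Classical in
theorem erase_mem_simplices {B : BarycentricChoice σ} {γ : Finset (NR N)} (hγ : γ ∈ simplices B)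
    (v : NR N) : γ.erase v ∈ simplices B := by
  obtain ⟨μ, hμ, h⟩ := hγ
  exact ⟨μ, hμ, (Finset.coe_subset.2 (Finset.erase_subset v γ)).trans h⟩

/-- The simplices of `C_Y` with `i` vertices, that is, of dimension `i - 1`; they correspond to the
`i`-dimensional cones of `Σ_Y`. -/
abbrev simplicesOfCard (B : BarycentricChoice σ) (i : ℕ) : Type _ :=
  {γ : Finset (NR N) // γ ∈ simplices B ∧ γ.card = i}

/-- The term in cohomological degree `i`: the direct sum (over a finite index set, hence the
product) of the spaces `V_γ^p` over the simplices `γ` with `i` vertices. In degree `0` this is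
`V_0^p = ⋀^p M_ℂ`, and it is zero in the degrees `i > p`. -/
abbrev term (B : BarycentricChoice σ) (p i : ℕ) : Type _ :=
  (γ : simplicesOfCard B i) → V p γ.1

open Classical in
/-- The facet of `ν` opposite to the vertex `v`. -/
abbrev facet {B : BarycentricChoice σ} {i : ℕ} (ν : simplicesOfCard B (i + 1)) {v : NR N}
    (hv : v ∈ ν.1) : simplicesOfCard B i :=
  ⟨ν.1.erase v, erase_mem_simplices ν.2.1 v, by
    rw [Finset.card_erase_of_mem hv, ν.2.2, Nat.add_sub_cancel]⟩

/-- The differential: the `V_ν^p`-coordinate of the image of `x` is the sum over the facets `μ`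
of `ν` of the images of the `V_μ^p`-coordinates of `x`. -/
def differential (B : BarycentricChoice σ) (p i : ℕ) : term B p i →ₗ[ℂ] term B p (i + 1) :=
  LinearMap.pi fun ν => ∑ v : ν.1,
    component p v.2 (rfl : (facet ν v.2).1 = _) ∘ₗ LinearMap.proj (facet ν v.2)

theorem differential_apply (B : BarycentricChoice σ) (p i : ℕ) (x : term B p i)
    (ν : simplicesOfCard B (i + 1)) :
    differential B p i x ν =
      ∑ v : ν.1, component p v.2 (rfl : (facet ν v.2).1 = _) (x (facet ν v.2)) := by
  simp [differential]

theorem differential_differential (B : BarycentricChoice σ) (p i : ℕ) (x : term B p i) :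
    differential B p (i + 1) (differential B p i x) = 0 := by
  classical
  funext ν
  have hx : ∀ (γ γ' : simplicesOfCard B i) (μ : Finset (NR N)) (w : NR N) (hw : w ∈ μ)
      (h : γ.1 = μ.erase w) (h' : γ'.1 = μ.erase w),
      component p hw h (x γ) = component p hw h' (x γ') := by
    rintro γ γ' μ w hw h h'
    obtain rfl : γ = γ' := Subtype.ext (h.trans h'.symm)
    rfl
  simp only [differential_apply, map_sum, Pi.zero_apply]
  rw [Finset.sum_sigma']
  refine Finset.sum_involution (fun a _ => ⟨⟨a.2.1, Finset.mem_of_mem_erase a.2.2⟩, ⟨a.1.1,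
    Finset.mem_erase.2 ⟨(Finset.ne_of_mem_erase a.2.2).symm, a.1.2⟩⟩⟩) ?_ ?_ ?_ ?_
  · rintro ⟨⟨v, hv⟩, ⟨w, hw⟩⟩ -
    have hw0 : w ∈ ν.1 := Finset.mem_of_mem_erase hw
    have hv' : v ∈ ν.1.erase w := Finset.mem_erase.2 ⟨(Finset.ne_of_mem_erase hw).symm, hv⟩
    have hcomm : (ν.1.erase v).erase w = (ν.1.erase w).erase v := Finset.erase_right_comm
    have key := component_component (p := p) hv hw0 rfl rfl hw hv' rfl hcomm
      (x (facet (facet ν hv) hw))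
    dsimp only
    rw [key, hx (facet (facet ν hv) hw) (facet (facet ν hw0) hv') _ _ hv' hcomm rfl]
    exact neg_add_cancel _
  · rintro ⟨⟨v, hv⟩, ⟨w, hw⟩⟩ - - heq
    have h1 : w = v := congrArg (fun a => a.1.1) heq
    exact Finset.ne_of_mem_erase hw h1
  · intro a _; exact Finset.mem_univ _
  · rintro ⟨⟨v, hv⟩, ⟨w, hw⟩⟩ -; rfl

open CategoryTheory in
/-- The degree-`0` part of the pushforward of the Ishida complex of the barycentric subdivision:
`0 → V_0^p → ⨁_{dim γ = 0} V_γ^p → ⨁_{dim γ = 1} V_γ^p → ⋯ → ⨁_{dim γ = p-1} V_γ^p → 0`,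
with `V_0^p` in cohomological degree `0`. -/
def ishidaComplex (B : BarycentricChoice σ) (p : ℕ) : CochainComplex (ModuleCat ℂ) ℕ :=
  CochainComplex.of (fun i => ModuleCat.of ℂ (term B p i))
    (fun i => ModuleCat.ofHom (differential B p i))
    (fun i => by
      rw [← ModuleCat.ofHom_comp]
      ext x
      exact congrFun (differential_differential B p i x) _)

end ToricIshida
end

/-! Evaluation at the vertices trivializes the lines `M_ℂ/v^⊥`. A cochain then assigns to each
simplex `γ` with `r` vertices an element of `⋀^(p-r) γ^⊥`, and the differential becomes
`coboundary`, a sum of contractions (`toExtPerp_component`). The terms vanish in degrees above `p`,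
so what remains is that every cocycle of degree `i < p` is a coboundary.

The vertices of a maximal simplex `F` are a basis of `N_ℝ`, with a dual basis `e_v` of `M_ℂ`. On the
simplices `γ` of an interval `R ⊆ γ ⊆ F`, put `(h x)(γ) = ∑ e_v ∧ x(γ ∪ {v})` over `v ∈ F \ γ`. Then
`dh + hd` is multiplication by `p - |R|`: the vertices in `γ \ R` contribute `|γ| - |R|`, and
Euler's formula (`IsDualBasis.sum_mul_contract`) contributes `p - |γ|`. In degree `i < p` one has
`|R| ≤ i`, so this scalar is invertible and the interval is acyclic there.

A shelling cuts the whole complex into such intervals and orders them so that the differential never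
raises the key. A cocycle is then killed one interval at a time (`Shelling.exists_reduction`,
`Shelling.exists_primitive`).

The shelling comes from convexity. Lifting `ρ_ν` to height `-T^(dim ν)` with `T` large shows that
the subdivision is regular (`exists_height`). Each maximal simplex carries the linear function that
interpolates the heights of its vertices, and the maximal simplices are ordered by the value of this
function at a generic point near the apex `ρ_σ`. Facets that contain the apex have a neighbour, by
the diamond property of the face lattice (`exists_other_face`); the facet opposite to the apex
causes no trouble because the point is close to the apex (`nonempty_shelling`). -/

noncomputable section

namespace ToricIshida

/-! ### Faces of finitely generated cones -/

section Cones

variable {E : Type*} [AddCommGroup E] [Module ℝ E]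

/-- Gordan's theorem: finitely many vectors without a nontrivial nonnegative relation lie in an
open half-space. -/
theorem exists_dual_pos_of_no_relation [FiniteDimensional ℝ E] {ι : Type*} [Fintype ι] (t : ι → E)
    (h : ∀ c : ι → ℝ, (∀ i, 0 ≤ c i) → ∑ i, c i • t i = 0 → c = 0) :
    ∃ f : Module.Dual ℝ E, ∀ i, 0 < f (t i) := by
  classical
  let φ := (Module.finBasis ℝ E).equivFun
  have h0 : (0 : Fin (Module.finrank ℝ E) → ℝ) ∉ convexHull ℝ (Set.range fun i => φ (t i)) := by
    intro hmem
    rw [convexHull_range_eq_exists_affineCombination] at hmem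
    obtain ⟨s, w, hw, hw1, hsum⟩ := hmem
    rw [Finset.affineCombination_eq_linear_combination _ _ _ hw1] at hsum
    have hc := h (fun i => if i ∈ s then w i else 0)
      (fun i => by
        by_cases hi : i ∈ s
        · simpa [hi] using hw i hi
        · simp [hi])
      (by
        apply φ.injective
        rw [map_zero, ← hsum]
        simp [ite_smul])
    have : ∑ i ∈ s, w i = 0 := Finset.sum_eq_zero fun i hi => by
      simpa [hi] using congrFun hc i
    linarith
  obtain ⟨f, u, hu, hf⟩ := geometric_hahn_banach_point_closed (convex_convexHull ℝ _)
    ((Set.finite_range fun i => φ (t i)).isClosed_convexHull (𝕜 := ℝ)) h0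
  rw [map_zero] at hu
  exact ⟨(f : (Fin (Module.finrank ℝ E) → ℝ) →ₗ[ℝ] ℝ) ∘ₗ φ.toLinearMap, fun i =>
    hu.trans (hf _ (subset_convexHull ℝ _ ⟨i, rfl⟩))⟩

theorem exists_sub_of_mem_span {μ : PointedCone ℝ E} {x : E}
    (hx : x ∈ Submodule.span ℝ (μ : Set E)) : ∃ a ∈ μ, ∃ b ∈ μ, x = a - b := by
  induction hx using Submodule.span_induction with
  | mem x hx => exact ⟨x, hx, 0, zero_mem _, by simp⟩
  | zero => exact ⟨0, zero_mem _, 0, zero_mem _, by simp⟩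
  | add x y _ _ hx hy =>
    obtain ⟨a, ha, b, hb, rfl⟩ := hx
    obtain ⟨a', ha', b', hb', rfl⟩ := hy
    exact ⟨a + a', add_mem ha ha', b + b', add_mem hb hb', by abel⟩
  | smul c x _ hx =>
    obtain ⟨a, ha, b, hb, rfl⟩ := hx
    rcases le_total 0 c with hc | hc
    · exact ⟨c • a, PointedCone.smul_mem _ hc ha, c • b, PointedCone.smul_mem _ hc hb,
        smul_sub ..⟩
    · have hc' : 0 ≤ -c := by linarith
      exact ⟨(-c) • b, PointedCone.smul_mem _ hc' hb, (-c) • a, PointedCone.smul_mem _ hc' ha,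
        by module⟩

theorem nonneg_on_hull {S : Set E} {u : Module.Dual ℝ E} (hu : ∀ s ∈ S, 0 ≤ u s) :
    ∀ x ∈ PointedCone.hull ℝ S, 0 ≤ u x := by
  intro x hx
  induction hx using Submodule.span_induction with
  | mem x hx => exact hu x hx
  | zero => simp
  | add x y _ _ hx hy => rw [map_add]; exact add_nonneg hx hy
  | smul c x _ hx =>
    rw [show c • x = (c : ℝ) • x from rfl, map_smul]
    exact mul_nonneg c.2 hx

/-- Each face of a finitely generated cone is exposed. -/
theorem exists_exposing [FiniteDimensional ℝ E] {σ μ : PointedCone ℝ E} (S : Finset E)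
    (hS : σ = PointedCone.hull ℝ (S : Set E)) (hμ : μ.IsFaceOf σ) :
    ∃ u : Module.Dual ℝ E, (∀ x ∈ σ, 0 ≤ u x) ∧ ∀ x ∈ σ, u x = 0 ↔ x ∈ μ := by
  classical
  have hSσ : ∀ s ∈ S, s ∈ σ := fun s hs => hS ▸ PointedCone.subset_hull (R := ℝ) hs
  let W := Submodule.span ℝ (μ : Set E)
  let T := S.filter fun s => s ∉ μ
  have hT : ∀ s : T, (s : E) ∈ S ∧ (s : E) ∉ μ := fun s => Finset.mem_filter.1 s.2
  -- Gordan's theorem is applied modulo the span of `μ`, to the generators outside `μ`. A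
  -- nonnegative relation there puts the sum in `μ - μ`, hence in `μ` because `μ` is a face, and
  -- then every generator with positive coefficient would lie in `μ`.
  obtain ⟨f, hf⟩ := exists_dual_pos_of_no_relation
    (fun s : T => W.mkQ (s : E)) (by
      intro c hc hsum
      have h1 : ∑ s : T, c s • (s : E) ∈ W := by
        rw [← Submodule.Quotient.mk_eq_zero W, ← Submodule.mkQ_apply, map_sum, ← hsum]
        simp
      obtain ⟨a, ha, b, hb, hab⟩ := exists_sub_of_mem_span h1
      have h2 : ∑ s : T, c s • (s : E) ∈ μ := by
        refine hμ.mem_of_add_mem_left (y := b) ?_ (hμ.le hb) (by rw [hab]; simpa using ha)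
        exact sum_mem fun s _ => PointedCone.smul_mem _ (hc s) (hSσ s (hT s).1)
      funext s
      by_contra hne
      exact (hT s).2 (hμ.mem_of_sum_smul_mem (fun s : T => hSσ s (hT s).1) hc h2 s
        (lt_of_le_of_ne (hc s) (Ne.symm hne))))
  have hzero : ∀ x ∈ μ, (f ∘ₗ W.mkQ) x = 0 := fun x hx => by
    have : W.mkQ x = 0 := (Submodule.Quotient.mk_eq_zero W).2 (Submodule.subset_span hx)
    rw [LinearMap.comp_apply, this, map_zero]
  have hgen : ∀ s ∈ S, s ∉ μ → 0 < (f ∘ₗ W.mkQ) s := fun s hs hsμ =>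
    hf ⟨s, Finset.mem_filter.2 ⟨hs, hsμ⟩⟩
  have hnonneg : ∀ x ∈ σ, 0 ≤ (f ∘ₗ W.mkQ) x := by
    rw [hS]
    refine nonneg_on_hull fun s hs => ?_
    by_cases hsμ : s ∈ μ
    · exact (hzero s hsμ).ge
    · exact (hgen s hs hsμ).le
  refine ⟨f ∘ₗ W.mkQ, hnonneg, fun x hx => ⟨?_, hzero x⟩⟩
  have hx' := hx
  rw [hS] at hx'
  clear hx
  induction hx' using Submodule.span_induction with
  | mem x hx => exact fun h => by_contra fun hxμ => (hgen x hx hxμ).ne' h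
  | zero => exact fun _ => zero_mem _
  | add x y hx hy hxi hyi =>
    intro h
    rw [map_add] at h
    have h1 := hnonneg x (hS ▸ hx)
    have h2 := hnonneg y (hS ▸ hy)
    exact add_mem (hxi (by linarith)) (hyi (by linarith))
  | smul c x hx hxi =>
    intro h
    rw [show c • x = (c : ℝ) • x from rfl, map_smul, smul_eq_mul, mul_eq_zero] at h
    rcases h with h | h
    · rw [show c • x = (c : ℝ) • x from rfl, h, zero_smul]; exact zero_mem _
    · exact Submodule.smul_mem _ _ (hxi h)

/-- A linear form that is nonnegative on a cone cuts out a face. -/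
theorem isFaceOf_of_nonneg {τ : PointedCone ℝ E} {g : Module.Dual ℝ E} (hg : ∀ x ∈ τ, 0 ≤ g x) :
    ∃ μ : PointedCone ℝ E, μ.IsFaceOf τ ∧ ∀ x, x ∈ μ ↔ x ∈ τ ∧ g x = 0 := by
  refine ⟨{ carrier := {x | x ∈ τ ∧ g x = 0}
            add_mem' := fun {a b} ha hb => ⟨add_mem ha.1 hb.1, by rw [map_add, ha.2, hb.2, add_zero]⟩
            zero_mem' := ⟨zero_mem _, map_zero g⟩
            smul_mem' := fun c x hx => ⟨Submodule.smul_mem _ c hx.1, by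
              rw [show c • x = (c : ℝ) • x from rfl, map_smul, hx.2, smul_zero]⟩ },
    ⟨fun x hx => hx.1, ?_⟩, fun x => Iff.rfl⟩
  intro x y a hx hy ha h
  have h2 : g (a • x + y) = 0 := h.2
  rw [map_add, map_smul, smul_eq_mul] at h2
  have h3 := hg y hy
  have h4 := mul_nonneg ha.le (hg x hx)
  have h5 : a * g x = 0 := by linarith
  exact ⟨hx, (mul_eq_zero.1 h5).resolve_left ha.ne'⟩

theorem eq_zero_on_span_of_eq_zero {μ : PointedCone ℝ E} {u : Module.Dual ℝ E}
    (h : ∀ x ∈ μ, u x = 0) {x : E} (hx : x ∈ Submodule.span ℝ (μ : Set E)) : u x = 0 := by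
  have : Submodule.span ℝ (μ : Set E) ≤ LinearMap.ker u := Submodule.span_le.2 h
  exact this hx

/-- A functional exposing the face vanishes on its span, and its zeros in the cone are exactly the
face. -/
theorem mem_face_of_mem_span [FiniteDimensional ℝ E] {σ μ : PointedCone ℝ E} (S : Finset E)
    (hS : σ = PointedCone.hull ℝ (S : Set E)) (hμ : μ.IsFaceOf σ) {x : E} (hxσ : x ∈ σ)
    (hx : x ∈ Submodule.span ℝ (μ : Set E)) : x ∈ μ := by
  obtain ⟨u, -, hu⟩ := exists_exposing S hS hμ
  exact (hu x hxσ).1 (eq_zero_on_span_of_eq_zero (fun y hy => (hu y (hμ.le hy)).2 hy) hx)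

theorem face_le_of_finrank_le [FiniteDimensional ℝ E] {σ μ τ : PointedCone ℝ E} (S : Finset E)
    (hS : σ = PointedCone.hull ℝ (S : Set E)) (hμ : μ.IsFaceOf σ) (hτ : τ.IsFaceOf σ)
    (hle : μ ≤ τ) (hd : Module.finrank ℝ (Submodule.span ℝ (τ : Set E)) ≤
      Module.finrank ℝ (Submodule.span ℝ (μ : Set E))) : τ ≤ μ := by
  have := Submodule.eq_of_le_of_finrank_le
    (Submodule.span_mono (R := ℝ) (SetLike.coe_subset_coe.2 hle)) hd
  intro x hx
  exact mem_face_of_mem_span S hS hμ (hτ.le hx) (this ▸ Submodule.subset_span hx)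

theorem face_finrank_lt [FiniteDimensional ℝ E] {σ μ τ : PointedCone ℝ E} (S : Finset E)
    (hS : σ = PointedCone.hull ℝ (S : Set E)) (hμ : μ.IsFaceOf σ) (hτ : τ.IsFaceOf σ)
    (hle : μ ≤ τ) {x : E} (hxτ : x ∈ τ) (hxμ : x ∉ μ) :
    Module.finrank ℝ (Submodule.span ℝ (μ : Set E)) <
      Module.finrank ℝ (Submodule.span ℝ (τ : Set E)) := by
  by_contra h
  exact hxμ (face_le_of_finrank_le S hS hμ hτ hle (not_lt.1 h) hxτ)

/-- By the face property, a nonnegative combination of generators that lies in `μ` only involves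
generators in `μ`. Hence faces are finite in number, and inequalities on a face can be tested on
generators. -/
theorem eq_hull_of_isFaceOf {σ μ : PointedCone ℝ E} (S : Set E)
    (hS : σ = PointedCone.hull ℝ S) (hμ : μ.IsFaceOf σ) :
    μ = PointedCone.hull ℝ (S ∩ μ) := by
  refine le_antisymm (fun x hx => ?_) (Submodule.span_le.2 Set.inter_subset_right)
  have hx' : x ∈ PointedCone.hull ℝ S := hS ▸ hμ.le hx
  induction hx' using Submodule.span_induction with
  | mem y hy => exact Submodule.subset_span ⟨hy, hx⟩
  | zero => exact zero_mem _
  | add y z hy hz hyi hzi =>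
    have := (hμ.add_mem_iff_mem (hS ▸ hy) (hS ▸ hz)).1 hx
    exact add_mem (hyi this.1) (hzi this.2)
  | smul c y hy hyi =>
    rcases eq_or_lt_of_le c.2 with hc | hc
    · rw [show c • y = (c : ℝ) • y from rfl, ← hc, zero_smul]; exact zero_mem _
    · refine Submodule.smul_mem _ c (hyi ?_)
      exact hμ.mem_of_smul_add_mem (y := 0) (hS ▸ hy) (zero_mem _) hc (by simpa using hx)

theorem finite_faces {σ : PointedCone ℝ E} (S : Finset E)
    (hS : σ = PointedCone.hull ℝ (S : Set E)) : {μ : PointedCone ℝ E | μ.IsFaceOf σ}.Finite := by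
  refine Set.Finite.of_finite_image (f := fun μ => (S : Set E) ∩ μ)
    (S.finite_toSet.finite_subsets.subset ?_) ?_
  · rintro _ ⟨μ, -, rfl⟩
    exact Set.inter_subset_left
  · intro μ hμ ν hν h
    rw [eq_hull_of_isFaceOf _ hS hμ, eq_hull_of_isFaceOf _ hS hν]
    exact congrArg _ h

/-- The diamond property of the face lattice of a cone. -/
theorem exists_other_face [FiniteDimensional ℝ E] {σ κ μ τ : PointedCone ℝ E} (S : Finset E)
    (hS : σ = PointedCone.hull ℝ (S : Set E)) (hκ : κ.IsFaceOf σ) (hμ : μ.IsFaceOf σ)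
    (hτ : τ.IsFaceOf σ) (hκμ : κ ≤ μ) (hμτ : μ ≤ τ) {d : ℕ}
    (hdκ : Module.finrank ℝ (Submodule.span ℝ (κ : Set E)) = d)
    (hdμ : Module.finrank ℝ (Submodule.span ℝ (μ : Set E)) = d + 1)
    (hdτ : Module.finrank ℝ (Submodule.span ℝ (τ : Set E)) = d + 2) :
    ∃ ν : PointedCone ℝ E, ν.IsFaceOf σ ∧ κ ≤ ν ∧ ν ≤ τ ∧ ν ≠ μ ∧
      Module.finrank ℝ (Submodule.span ℝ (ν : Set E)) = d + 1 := by
  classical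
  obtain ⟨f, hf, hfκ⟩ := exists_exposing S hS hκ
  obtain ⟨u, hu, huμ⟩ := exists_exposing S hS hμ
  have hSσ : ∀ s ∈ S, s ∈ σ := fun s hs => hS ▸ PointedCone.subset_hull (R := ℝ) hs
  have hτgen := eq_hull_of_isFaceOf (S : Set E) hS hτ
  let A := S.filter fun s => s ∈ τ ∧ s ∉ μ
  have hA : A.Nonempty := by
    by_contra hne
    have : τ ≤ μ := by
      rw [hτgen]
      refine Submodule.span_le.2 fun s hs => ?_
      by_contra hsμ
      exact hne ⟨s, Finset.mem_filter.2 ⟨hs.1, hs.2, hsμ⟩⟩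
    have h1 := Submodule.finrank_mono (Submodule.span_mono (R := ℝ) (SetLike.coe_subset_coe.2 this))
    omega
  have hpos : ∀ s ∈ A, 0 < u s := fun s hs => by
    obtain ⟨hs, -, hsμ⟩ := Finset.mem_filter.1 hs
    exact lt_of_le_of_ne (hu s (hSσ s hs)) fun h => hsμ ((huμ s (hSσ s hs)).1 h.symm)
  -- Tilt `f` by the largest multiple of `u` that keeps it nonnegative on `τ`. The tilted form still
  -- vanishes on `κ`, now also at `s₀ ∉ μ`, and stays positive on `μ` outside `κ`, where `u`
  -- vanishes.
  obtain ⟨s₀, hs₀, hmin⟩ := A.exists_min_image (fun s => f s / u s) hA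
  obtain ⟨hs₀S, hs₀τ, hs₀μ⟩ := Finset.mem_filter.1 hs₀
  let g : Module.Dual ℝ E := f - (f s₀ / u s₀) • u
  have hgapp : ∀ x, g x = f x - f s₀ / u s₀ * u x := fun x => rfl
  have hg : ∀ x ∈ τ, 0 ≤ g x := by
    rw [hτgen]
    refine nonneg_on_hull fun s hs => ?_
    rw [hgapp]
    by_cases hsμ : s ∈ μ
    · rw [(huμ s (hSσ s hs.1)).2 hsμ, mul_zero, sub_zero]
      exact hf s (hSσ s hs.1)
    · have hsA : s ∈ A := Finset.mem_filter.2 ⟨hs.1, hs.2, hsμ⟩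
      have := hmin s hsA
      rw [le_div_iff₀ (hpos s hsA)] at this
      linarith
  obtain ⟨ν, hν, hνmem⟩ := isFaceOf_of_nonneg hg
  have hνσ : ν.IsFaceOf σ := hν.trans hτ
  have hκν : κ ≤ ν := fun x hx => (hνmem x).2 ⟨hμτ (hκμ hx), by
    rw [hgapp, (hfκ x (hκ.le hx)).2 hx, (huμ x (hκ.le hx)).2 (hκμ hx)]; simp⟩
  have hs₀ν : s₀ ∈ ν := (hνmem s₀).2 ⟨hs₀τ, by
    rw [hgapp, div_mul_cancel₀ _ (hpos s₀ hs₀).ne', sub_self]⟩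
  have hs₀κ : s₀ ∉ κ := fun h => hs₀μ (hκμ h)
  obtain ⟨x, hxμ, hxκ⟩ : ∃ x ∈ μ, x ∉ κ := by
    by_contra! hle
    have h1 := Submodule.finrank_mono (Submodule.span_mono (R := ℝ) (SetLike.coe_subset_coe.2
      (show μ ≤ κ from hle)))
    omega
  have hxν : x ∉ ν := fun h => by
    have h1 := ((hνmem x).1 h).2
    rw [hgapp, (huμ x (hμ.le hxμ)).2 hxμ, mul_zero, sub_zero] at h1
    exact hxκ ((hfκ x (hμ.le hxμ)).1 h1)
  -- The inclusions `κ < ν < τ` are strict, which leaves only `d + 1` for the dimension of `ν`.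
  have h1 := face_finrank_lt S hS hκ hνσ hκν hs₀ν hs₀κ
  have h2 := face_finrank_lt S hS hνσ hτ hν.le (hμτ hxμ) hxν
  exact ⟨ν, hνσ, hκν, hν.le, fun h => hxν (h ▸ hxμ), by omega⟩

end Cones

/-! ### Triangular systems and dominance of the leading term -/

section Triangular

variable {E : Type*} [AddCommGroup E] [Module ℝ E] {n : ℕ}

theorem triangular_apply_sum {v : Fin n → E} {u : Fin n → Module.Dual ℝ E}
    (hlt : ∀ i j, j < i → u i (v j) = 0) {a : Fin n → ℝ} {m : Fin n} (ha : ∀ i, m < i → a i = 0) :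
    u m (∑ i, a i • v i) = a m * u m (v m) := by
  rw [map_sum, Finset.sum_eq_single m]
  · simp
  · intro j _ hj
    rcases lt_or_gt_of_ne hj with h | h
    · rw [map_smul, hlt m j h, smul_zero]
    · rw [ha j h, zero_smul, map_zero]
  · simp

theorem exists_last_ne_zero {a : Fin n → ℝ} (ha : a ≠ 0) :
    ∃ m, a m ≠ 0 ∧ ∀ i, m < i → a i = 0 := by
  classical
  obtain ⟨i, hi⟩ := Function.ne_iff.1 ha
  let A := Finset.univ.filter fun i => a i ≠ 0
  have hA : A.Nonempty := ⟨i, by simpa [A] using hi⟩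
  refine ⟨A.max' hA, (Finset.mem_filter.1 (A.max'_mem hA)).2, fun j hj => ?_⟩
  by_contra h
  exact absurd (A.le_max' j (by simpa [A] using h)) (not_le.2 hj)

theorem linearIndependent_of_triangular {v : Fin n → E} {u : Fin n → Module.Dual ℝ E}
    (hlt : ∀ i j, j < i → u i (v j) = 0) (hpos : ∀ i, 0 < u i (v i)) :
    LinearIndependent ℝ v := by
  rw [Fintype.linearIndependent_iff]
  intro a ha
  by_contra! hne
  obtain ⟨i, hi⟩ := hne
  obtain ⟨m, hm, hlast⟩ := exists_last_ne_zero (a := a) (fun h => hi (congrFun h i))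
  have := triangular_apply_sum hlt hlast
  rw [ha, map_zero] at this
  exact hm ((mul_eq_zero.1 this.symm).resolve_right (hpos m).ne')

open Filter in
-- The right side is a polynomial in `T` of degree `m + 1` with leading coefficient `a m > 0`, and
-- `d ≤ m`. The exponent `i + 1` is the dimension of the `i`-th face of a flag.
theorem eventually_pow_lt_sum {a : Fin n → ℝ} {m : Fin n} (hm : 0 < a m)
    (hlast : ∀ i, m < i → a i = 0) {d : ℕ} (hd : d ≤ m) :
    ∀ᶠ T : ℝ in atTop, T ^ d < ∑ i, a i * T ^ ((i : ℕ) + 1) := by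
  let P : Polynomial ℝ := ∑ i, Polynomial.C (a i) * Polynomial.X ^ ((i : ℕ) + 1) -
    Polynomial.X ^ d
  have hcoeff : P.coeff ((m : ℕ) + 1) = a m := by
    simp only [P, Polynomial.coeff_sub, Polynomial.finsetSum_coeff, Polynomial.coeff_C_mul_X_pow,
      Polynomial.coeff_X_pow]
    rw [if_neg (by omega), sub_zero, Finset.sum_eq_single m]
    · simp
    · intro j _ hj
      rw [if_neg]
      intro h
      exact hj (Fin.ext (by omega))
    · simp
  have hdeg : P.natDegree ≤ m + 1 := by
    refine (Polynomial.natDegree_sub_le _ _).trans (max_le ?_ ?_)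
    · refine Polynomial.natDegree_sum_le_of_forall_le _ _ fun i _ => ?_
      rcases lt_or_ge m i with h | h
      · simp [hlast i h]
      · refine (Polynomial.natDegree_C_mul_X_pow_le _ _).trans ?_
        have : (i : ℕ) ≤ m := h
        omega
    · rw [Polynomial.natDegree_X_pow]; omega
  have hnat : P.natDegree = m + 1 :=
    Polynomial.natDegree_eq_of_le_of_coeff_ne_zero hdeg (by rw [hcoeff]; exact hm.ne')
  have hlead : P.leadingCoeff = a m := by rw [Polynomial.leadingCoeff, hnat, hcoeff]
  have htend := P.tendsto_atTop_of_leadingCoeff_nonneg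
    (Polynomial.natDegree_pos_iff_degree_pos.1 (by omega)) (by rw [hlead]; exact hm.le)
  filter_upwards [htend.eventually_gt_atTop 0] with T hT
  simpa [P, Polynomial.eval_finsetSum] using hT

end Triangular

/-! ### Flags of faces and regularity of the barycentric subdivision -/

section Flags

variable {N : Type*} [AddCommGroup N]

theorem exists_extension_of_mem_relativeInterior {S : Set (NR N)} {x y : NR N}
    (hx : x ∈ relativeInterior S) (hy : y ∈ S) : ∃ ε : ℝ, 0 < ε ∧ x + ε • (x - y) ∈ S := by
  let _ : TopologicalSpace (NR N) := moduleTopology ℝ (NR N)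
  have : IsModuleTopology ℝ (NR N) := ⟨rfl⟩
  have : ContinuousAdd (NR N) := IsModuleTopology.toContinuousAdd ℝ (NR N)
  obtain ⟨x', hx', rfl⟩ := (mem_intrinsicInterior (𝕜 := ℝ)).1 hx
  -- The parameter `-t` makes positive `t` move away from `y`, beyond `x`, inside the affine span.
  let g : ℝ → affineSpan ℝ S := fun t =>
    ⟨AffineMap.lineMap (x' : NR N) y (-t), AffineMap.lineMap_mem _ x'.2 (mem_affineSpan ℝ hy)⟩
  have hg : Continuous g := by
    refine Continuous.subtype_mk ?_ _
    simp only [AffineMap.lineMap_apply, vsub_eq_sub, vadd_eq_add]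
    fun_prop
  have h0 : g 0 = x' := Subtype.ext (by simp [g])
  have hnhds : ∀ᶠ t in nhds (0 : ℝ), g t ∈ interior ((↑) ⁻¹' S : Set (affineSpan ℝ S)) :=
    hg.continuousAt.eventually_mem (by rw [h0]; exact isOpen_interior.mem_nhds hx')
  obtain ⟨ε, hε, hball⟩ := Metric.eventually_nhds_iff.1 hnhds
  refine ⟨ε / 2, by positivity, ?_⟩
  have := interior_subset (hball (y := ε / 2) (by
    rw [Real.dist_eq, sub_zero, abs_of_pos (by positivity)]; linarith))
  have h2 : AffineMap.lineMap (x' : NR N) y (-(ε / 2)) ∈ S := this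
  rw [AffineMap.lineMap_apply, vsub_eq_sub, vadd_eq_add] at h2
  convert h2 using 1
  module

variable {σ : PointedCone ℝ (NR N)}

/-- Each `y ∈ ν` can be completed by another point of `ν` so that a positive multiple of `ρ ν` is a
positive combination of the two; a face containing `ρ ν` must then contain `y`. -/
theorem le_of_rho_mem (B : BarycentricChoice σ) {μ ν : PointedCone ℝ (NR N)}
    (hν : ν.IsFaceOf σ) (hne : ν ≠ ⊥) (hμ : μ.IsFaceOf σ) (h : B.ρ ν ∈ μ) : ν ≤ μ := by
  intro y hy
  obtain ⟨ε, hε, hz⟩ := exists_extension_of_mem_relativeInterior (B.ρ_mem_interior ν hν hne) hy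
  refine hμ.mem_of_smul_add_mem (hν.le hy) (hν.le hz) hε ?_
  have : ε • y + (B.ρ ν + ε • (B.ρ ν - y)) = (1 + ε) • B.ρ ν := by module
  rw [this]
  exact PointedCone.smul_mem _ (by positivity) h

theorem rho_mem (B : BarycentricChoice σ) {ν : PointedCone ℝ (NR N)}
    (hν : ν.IsFaceOf σ) (hne : ν ≠ ⊥) : B.ρ ν ∈ ν :=
  @intrinsicInterior_subset ℝ _ _ _ _ _ (moduleTopology ℝ (NR N)) _ _ _
    (B.ρ_mem_interior ν hν hne)

theorem rho_injOn (B : BarycentricChoice σ) :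
    Set.InjOn B.ρ {ν | ν.IsFaceOf σ ∧ ν ≠ ⊥} := by
  intro μ hμ ν hν h
  exact le_antisymm (le_of_rho_mem B hμ.1 hμ.2 hν.1 (h ▸ rho_mem B hν.1 hν.2))
    (le_of_rho_mem B hν.1 hν.2 hμ.1 (h ▸ rho_mem B hμ.1 hμ.2))

theorem bot_isFaceOf (B : BarycentricChoice σ) : (⊥ : PointedCone ℝ (NR N)).IsFaceOf σ := by
  refine ⟨bot_le, fun {x y a} hx hy ha h => ?_⟩
  have h1 := congrArg B.l ((Submodule.mem_bot _).1 h)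
  rw [map_add, map_smul, smul_eq_mul, map_zero] at h1
  have h2 := mul_nonneg ha.le (B.l_nonneg x hx)
  have h3 := B.l_nonneg y hy
  have h4 : a * B.l x = 0 := by linarith
  exact (Submodule.mem_bot _).2 (B.l_eq_zero x hx ((mul_eq_zero.1 h4).resolve_left ha.ne'))

theorem coneDim_bot : coneDim (⊥ : PointedCone ℝ (NR N)) = 0 := by
  have : ((⊥ : PointedCone ℝ (NR N)) : Set (NR N)) = {0} := rfl
  rw [coneDim, this, Submodule.span_zero_singleton, finrank_bot]

variable {μ : Fin (Module.finrank ℤ N) → PointedCone ℝ (NR N)}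

theorem IsFlag.ne_bot (h : IsFlag σ μ) (i) : μ i ≠ ⊥ := by
  intro h0
  have := h.dim_eq i
  rw [h0, coneDim_bot] at this
  omega

/-- The face that precedes `μ i` in a flag. -/
theorem IsFlag.exists_previous (h : IsFlag σ μ) (B : BarycentricChoice σ)
    (i : Fin (Module.finrank ℤ N)) :
    ∃ κ : PointedCone ℝ (NR N), κ.IsFaceOf σ ∧ coneDim κ = i ∧ (∀ j < i, μ j ≤ κ) ∧ κ ≤ μ i := by
  obtain ⟨i, hi⟩ := i
  cases i with
  | zero => exact ⟨⊥, bot_isFaceOf B, coneDim_bot, fun j hj => absurd hj (Nat.not_lt_zero _),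
      bot_le⟩
  | succ k =>
    refine ⟨μ ⟨k, by omega⟩, h.isFaceOf _, h.dim_eq _, fun j hj => h.mono ?_, h.mono ?_⟩
    · have : (j : ℕ) < k + 1 := hj
      exact Fin.le_def.2 (by simp only; omega)
    · exact Fin.le_def.2 (by simp only; omega)

/-- The vertices of the maximal simplex given by a flag. -/
def flagVertices (B : BarycentricChoice σ)
    (μ : Fin (Module.finrank ℤ N) → PointedCone ℝ (NR N)) : Finset (NR N) :=
  open Classical in Finset.univ.image fun i => B.ρ (μ i)

theorem mem_flagVertices {B : BarycentricChoice σ} {v : NR N} :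
    v ∈ flagVertices B μ ↔ ∃ i, B.ρ (μ i) = v := by
  simp [flagVertices]

theorem finite_flags (S : Finset (NR N)) (hS : σ = PointedCone.hull ℝ (S : Set (NR N))) :
    {μ : Fin (Module.finrank ℤ N) → PointedCone ℝ (NR N) | IsFlag σ μ}.Finite :=
  (Set.Finite.pi' fun _ => finite_faces S hS).subset fun _ h => h.isFaceOf

theorem finrank_NR [Module.Free ℤ N] : Module.finrank ℝ (NR N) = Module.finrank ℤ N :=
  Module.finrank_baseChange

variable [Module.Finite ℤ N]

/-- Take `u i` exposing the face that precedes `μ i`. It kills the earlier barycenters, and it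
cannot kill `ρ (μ i)`, since `μ i` would then lie in a face of smaller dimension. -/
theorem IsFlag.exists_triangular (h : IsFlag σ μ) (B : BarycentricChoice σ) (S : Finset (NR N))
    (hS : σ = PointedCone.hull ℝ (S : Set (NR N))) :
    ∃ u : Fin (Module.finrank ℤ N) → Module.Dual ℝ (NR N), (∀ i, ∀ x ∈ σ, 0 ≤ u i x) ∧
      (∀ i j, j < i → u i (B.ρ (μ j)) = 0) ∧ ∀ i, 0 < u i (B.ρ (μ i)) := by
  have key : ∀ i, ∃ u : Module.Dual ℝ (NR N), (∀ x ∈ σ, 0 ≤ u x) ∧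
      (∀ j, j < i → u (B.ρ (μ j)) = 0) ∧ 0 < u (B.ρ (μ i)) := by
    intro i
    obtain ⟨κ, hκ, hdim, hlt, -⟩ := h.exists_previous B i
    obtain ⟨u, hu, hu0⟩ := exists_exposing S hS hκ
    have hmem : ∀ j, B.ρ (μ j) ∈ μ j := fun j => rho_mem B (h.isFaceOf j) (h.ne_bot j)
    refine ⟨u, hu, fun j hj => (hu0 _ ((h.isFaceOf j).le (hmem j))).2 (hlt j hj (hmem j)), ?_⟩
    refine lt_of_le_of_ne (hu _ ((h.isFaceOf i).le (hmem i))) fun h0 => ?_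
    have h1 := (hu0 _ ((h.isFaceOf i).le (hmem i))).1 h0.symm
    have h2 := le_of_rho_mem B (h.isFaceOf i) (h.ne_bot i) hκ h1
    have h3 := Submodule.finrank_mono (Submodule.span_mono (R := ℝ) (SetLike.coe_subset_coe.2 h2))
    have h4 := h.dim_eq i
    unfold coneDim at h4 hdim
    omega
  choose u h1 h2 h3 using key
  exact ⟨u, h1, h2, h3⟩

theorem IsFlag.linearIndependent (h : IsFlag σ μ) (B : BarycentricChoice σ) (S : Finset (NR N))
    (hS : σ = PointedCone.hull ℝ (S : Set (NR N))) :
    LinearIndependent ℝ fun i => B.ρ (μ i) := by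
  obtain ⟨u, -, h1, h2⟩ := h.exists_triangular B S hS
  exact linearIndependent_of_triangular h1 h2

theorem IsFlag.linearIndepOn_flagVertices (h : IsFlag σ μ) (B : BarycentricChoice σ)
    (S : Finset (NR N)) (hS : σ = PointedCone.hull ℝ (S : Set (NR N))) :
    LinearIndependent ℝ fun v : flagVertices B μ => (v : NR N) := by
  have := (h.linearIndependent B S hS).linearIndepOn_id
  have hr : (Set.range fun i => B.ρ (μ i)) = (flagVertices B μ : Set (NR N)) := by
    ext v; simp [mem_flagVertices]
  rw [hr] at this
  exact this

variable [Module.Free ℤ N]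

/-- The last nonzero coordinate of `ρ ν` is detected by `u m`, which is nonnegative on `σ`, so it is
positive. Moreover `ρ ν` lies in the span of `μ m`, so `ν` is a proper face of `μ m`, and `dim μ m =
m + 1`. -/
theorem IsFlag.exists_coordinates (h : IsFlag σ μ) (B : BarycentricChoice σ) (S : Finset (NR N))
    (hS : σ = PointedCone.hull ℝ (S : Set (NR N))) {ν : PointedCone ℝ (NR N)}
    (hν : ν.IsFaceOf σ) (hne : ν ≠ ⊥) (hνμ : ∀ i, ν ≠ μ i) :
    ∃ a : Fin (Module.finrank ℤ N) → ℝ, B.ρ ν = ∑ i, a i • B.ρ (μ i) ∧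
      ∃ m, 0 < a m ∧ (∀ i, m < i → a i = 0) ∧ coneDim ν ≤ m := by
  obtain ⟨u, h1, h2, h3⟩ := h.exists_triangular B S hS
  have hli := h.linearIndependent B S hS
  let b := basisOfLinearIndependentOfCardEqFinrank' _ hli (by rw [finrank_NR, Fintype.card_fin])
  have hb : ∀ i, b i = B.ρ (μ i) := fun i => by simp [b]
  have hmem : ∀ j, B.ρ (μ j) ∈ μ j := fun j => rho_mem B (h.isFaceOf j) (h.ne_bot j)
  have hsum : B.ρ ν = ∑ i, b.repr (B.ρ ν) i • B.ρ (μ i) := by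
    simpa only [hb] using (b.sum_repr (B.ρ ν)).symm
  have hρσ := (B.ρ_mem_polytope ν hν hne).1
  have ha0 : (fun i => b.repr (B.ρ ν) i) ≠ 0 := fun h0 => by
    have : B.ρ ν = 0 := by
      rw [hsum]; exact Finset.sum_eq_zero fun i _ => by rw [congrFun h0 i]; simp
    have h4 := (B.ρ_mem_polytope ν hν hne).2
    rw [this, map_zero] at h4
    exact zero_ne_one h4
  obtain ⟨m, hm, hlast⟩ := exists_last_ne_zero ha0
  refine ⟨_, hsum, m, ?_, hlast, ?_⟩
  · have h4 := h1 m _ hρσ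
    rw [hsum, triangular_apply_sum (v := fun i => B.ρ (μ i)) h2 hlast] at h4
    exact lt_of_le_of_ne (nonneg_of_mul_nonneg_left h4 (h3 m)) hm.symm
  · have hνm : B.ρ ν ∈ μ m := by
      refine mem_face_of_mem_span S hS (h.isFaceOf m) hρσ ?_
      rw [hsum]
      refine sum_mem fun i _ => ?_
      rcases lt_or_ge m i with hi | hi
      · rw [hlast i hi, zero_smul]; exact zero_mem _
      · exact Submodule.smul_mem _ _ (Submodule.subset_span (h.mono hi (hmem i)))
    have hle := le_of_rho_mem B hν hne (h.isFaceOf m) hνm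
    obtain ⟨x, hx, hxν⟩ : ∃ x ∈ μ m, x ∉ ν := by
      by_contra! hcon
      exact hνμ m (le_antisymm hle hcon)
    have h5 := face_finrank_lt S hS hν (h.isFaceOf m) hle hx hxν
    have h6 := h.dim_eq m
    unfold coneDim at h6 ⊢
    omega

/-- Barycentric subdivisions are regular: if the vertex `ρ ν` is lifted to the height
`-T ^ dim ν` with `T` large, then the lifted maximal simplices are the lower facets. -/
theorem exists_height (B : BarycentricChoice σ) (S : Finset (NR N))
    (hS : σ = PointedCone.hull ℝ (S : Set (NR N))) :
    ∃ h : NR N → ℝ, ∀ μ, IsFlag σ μ → ∃ L : Module.Dual ℝ (NR N),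
      (∀ v ∈ flagVertices B μ, L v = h v) ∧
      ∀ μ', IsFlag σ μ' → ∀ v ∈ flagVertices B μ', v ∉ flagVertices B μ → L v < h v := by
  classical
  let faces : Set (PointedCone ℝ (NR N)) := {ν | ν.IsFaceOf σ ∧ ν ≠ ⊥}
  have hfaces : faces.Finite := (finite_faces S hS).subset fun ν hν => hν.1
  -- There are finitely many pairs of a flag and a face, so one `T` serves all of them.
  have hev : ∀ᶠ T : ℝ in Filter.atTop, ∀ μ ∈ {μ | IsFlag σ μ}, ∀ ν ∈ faces, (∀ i, ν ≠ μ i) →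
      ∃ a : Fin (Module.finrank ℤ N) → ℝ, B.ρ ν = ∑ i, a i • B.ρ (μ i) ∧
        T ^ coneDim ν < ∑ i, a i * T ^ ((i : ℕ) + 1) := by
    rw [Filter.eventually_all_finite (finite_flags S hS)]
    intro μ hμ
    rw [Filter.eventually_all_finite hfaces]
    intro ν hν
    by_cases hνμ : ∀ i, ν ≠ μ i
    · obtain ⟨a, ha, m, hm, hlast, hd⟩ := hμ.exists_coordinates B S hS hν.1 hν.2 hνμ
      filter_upwards [eventually_pow_lt_sum hm hlast hd] with T hT
      exact fun _ => ⟨a, ha, hT⟩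
    · exact Filter.Eventually.of_forall fun T h => absurd h hνμ
  obtain ⟨T, hT⟩ := hev.exists
  -- A barycenter determines its face by `rho_injOn`; values at other points are irrelevant.
  let h : NR N → ℝ := fun v => -T ^ coneDim (Function.invFunOn B.ρ faces v)
  have hh : ∀ ν ∈ faces, h (B.ρ ν) = -T ^ coneDim ν := fun ν hν => by
    simp only [h]
    rw [(rho_injOn B).leftInvOn_invFunOn hν]
  refine ⟨h, fun μ hμ => ?_⟩
  have hmf : ∀ μ, IsFlag σ μ → ∀ i, μ i ∈ faces := fun μ hμ i => ⟨hμ.isFaceOf i, hμ.ne_bot i⟩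
  have hli := hμ.linearIndependent B S hS
  let b := basisOfLinearIndependentOfCardEqFinrank' _ hli (by rw [finrank_NR, Fintype.card_fin])
  have hb : ∀ i, b i = B.ρ (μ i) := fun i => by simp [b]
  let L : Module.Dual ℝ (NR N) := b.constr ℝ fun i => -T ^ ((i : ℕ) + 1)
  have hL : ∀ i, L (B.ρ (μ i)) = -T ^ ((i : ℕ) + 1) := fun i => by
    rw [← hb i]; exact b.constr_basis ℝ _ i
  refine ⟨L, ?_, ?_⟩
  · intro v hv
    obtain ⟨i, rfl⟩ := mem_flagVertices.1 hv
    rw [hL, hh _ (hmf μ hμ i), hμ.dim_eq]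
  · intro μ' hμ' v hv hvμ
    obtain ⟨j, rfl⟩ := mem_flagVertices.1 hv
    obtain ⟨a, ha, hlt⟩ := hT μ hμ (μ' j) (hmf μ' hμ' j) fun i hi =>
      hvμ (mem_flagVertices.2 ⟨i, by rw [hi]⟩)
    rw [hh _ (hmf μ' hμ' j), ha, map_sum]
    simp only [map_smul, hL, smul_eq_mul, mul_neg, Finset.sum_neg_distrib]
    linarith

theorem IsFlag.card_flagVertices (h : IsFlag σ μ) (B : BarycentricChoice σ) (S : Finset (NR N))
    (hS : σ = PointedCone.hull ℝ (S : Set (NR N))) :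
    (flagVertices B μ).card = Module.finrank ℝ (NR N) := by
  classical
  rw [flagVertices, Finset.card_image_of_injective _ (h.linearIndependent B S hS).injective,
    finrank_NR]
  simp

theorem IsFlag.eq_of_last (h : IsFlag σ μ) (S : Finset (NR N))
    (hS : σ = PointedCone.hull ℝ (S : Set (NR N))) {i : Fin (Module.finrank ℤ N)}
    (hi : (i : ℕ) + 1 = Module.finrank ℤ N) : μ i = σ := by
  refine le_antisymm (h.isFaceOf i).le (face_le_of_finrank_le S hS (h.isFaceOf i) (.refl σ)
    (h.isFaceOf i).le ?_)
  have h1 := h.dim_eq i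
  have h2 := Submodule.finrank_le (Submodule.span ℝ (σ : Set (NR N)))
  rw [finrank_NR] at h2
  unfold coneDim at h1
  omega

/-- Each facet of a maximal simplex that contains the apex `ρ σ` lies in another maximal
simplex. -/
theorem IsFlag.exists_adjacent (h : IsFlag σ μ) (B : BarycentricChoice σ)
    (S : Finset (NR N)) (hS : σ = PointedCone.hull ℝ (S : Set (NR N))) {v : NR N}
    (hv : v ∈ flagVertices B μ) (hne : v ≠ B.ρ σ) :
    ∃ μ', IsFlag σ μ' ∧ v ∉ flagVertices B μ' ∧
      ∀ u ∈ flagVertices B μ, u ≠ v → u ∈ flagVertices B μ' := by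
  classical
  obtain ⟨i, rfl⟩ := mem_flagVertices.1 hv
  have hi : (i : ℕ) + 1 < Module.finrank ℤ N := by
    by_contra hcon
    exact hne (congrArg B.ρ (h.eq_of_last S hS (by have := i.2; omega)))
  let i' : Fin (Module.finrank ℤ N) := ⟨i + 1, hi⟩
  obtain ⟨κ, hκ, hdim, hlt, hκμ⟩ := h.exists_previous B i
  -- Only `μ i` is exchanged, for the other face between its two neighbours in the flag. The upper
  -- neighbour exists because the vertex is not the apex.
  obtain ⟨ν, hν, hκν, hντ, hνμ, hdν⟩ := exists_other_face S hS hκ (h.isFaceOf i) (h.isFaceOf i')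
    hκμ (h.mono (Fin.le_def.2 (Nat.le_succ _))) hdim (h.dim_eq i) (h.dim_eq i')
  have hν0 : ν ≠ ⊥ := by
    rintro rfl
    have := coneDim_bot (N := N)
    unfold coneDim at this
    omega
  have hflag : IsFlag σ (Function.update μ i ν) := by
    refine ⟨fun j => ?_, fun j => ?_, fun j k hjk => ?_⟩
    · rcases eq_or_ne j i with rfl | hj
      · simpa using hν
      · rw [Function.update_of_ne hj]; exact h.isFaceOf j
    · rcases eq_or_ne j i with rfl | hj
      · rw [Function.update_self]; exact hdν
      · rw [Function.update_of_ne hj]; exact h.dim_eq j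
    · rcases eq_or_ne j i with rfl | hj
      · rcases eq_or_ne k j with rfl | hk
        · exact le_rfl
        · rw [Function.update_self, Function.update_of_ne hk]
          refine hντ.trans (h.mono (Fin.le_def.2 ?_))
          have : (j : ℕ) < k := lt_of_le_of_ne (Fin.le_def.1 hjk) (fun h' => hk (Fin.ext h'.symm))
          exact this
      · rw [Function.update_of_ne hj]
        rcases eq_or_ne k i with rfl | hk
        · rw [Function.update_self]
          exact (hlt j (lt_of_le_of_ne hjk hj)).trans hκν
        · rw [Function.update_of_ne hk]; exact h.mono hjk
  refine ⟨_, hflag, fun hmem => ?_, fun u hu huv => ?_⟩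
  · obtain ⟨j, hj⟩ := mem_flagVertices.1 hmem
    have hji := rho_injOn B ⟨hflag.isFaceOf j, hflag.ne_bot j⟩ ⟨h.isFaceOf i, h.ne_bot i⟩ hj
    rcases eq_or_ne j i with rfl | hne'
    · rw [Function.update_self] at hji
      exact hνμ hji
    · rw [Function.update_of_ne hne'] at hji
      have h1 := h.dim_eq j
      rw [hji, h.dim_eq i] at h1
      exact hne' (Fin.ext (by omega))
  · obtain ⟨j, rfl⟩ := mem_flagVertices.1 hu
    have hj : j ≠ i := fun h' => huv (by rw [h'])
    exact mem_flagVertices.2 ⟨j, by rw [Function.update_of_ne hj]⟩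

/-- Nonemptiness excludes rank `0`, where the flag is empty and has no vertex. -/
theorem IsFlag.apex_mem (h : IsFlag σ μ) (B : BarycentricChoice σ)
    (S : Finset (NR N)) (hS : σ = PointedCone.hull ℝ (S : Set (NR N)))
    (hne : (flagVertices B μ).Nonempty) : B.ρ σ ∈ flagVertices B μ := by
  obtain ⟨v, hv⟩ := hne
  obtain ⟨i, -⟩ := mem_flagVertices.1 hv
  have := i.2
  exact mem_flagVertices.2 ⟨⟨Module.finrank ℤ N - 1, by omega⟩, congrArg B.ρ
    (h.eq_of_last S hS (Nat.sub_add_cancel (by omega)))⟩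

end Flags

/-! ### Shellings of regular subdivisions -/

/-- A shelling of the simplicial complex with the maximal simplices `𝓕`: each simplex `γ` is
assigned to a maximal simplex `owner γ` containing it, the simplices assigned to `F` form the
interval `[restriction F, F]`, and a linear order on `𝓕` (given by `key`) makes `owner`
antitone. -/
structure Shelling {E : Type*} (𝓕 : Finset (Finset E)) where
  key : Finset E → ℕ
  owner : Finset E → Finset E
  restriction : Finset E → Finset E
  owner_mem : ∀ γ, (∃ F ∈ 𝓕, γ ⊆ F) → owner γ ∈ 𝓕
  subset_owner : ∀ γ, (∃ F ∈ 𝓕, γ ⊆ F) → γ ⊆ owner γ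
  restriction_subset : ∀ γ, (∃ F ∈ 𝓕, γ ⊆ F) → restriction (owner γ) ⊆ γ
  owner_eq : ∀ F ∈ 𝓕, ∀ γ, restriction F ⊆ γ → γ ⊆ F → owner γ = F
  key_owner_le : ∀ γ γ', γ ⊆ γ' → (∃ F ∈ 𝓕, γ' ⊆ F) → key (owner γ') ≤ key (owner γ)
  key_injOn : Set.InjOn key 𝓕

section Subdivision

variable {E : Type*} [AddCommGroup E] [Module ℝ E]

open Classical in
theorem exists_dual_coordinates [FiniteDimensional ℝ E] {F : Finset E}
    (hcard : F.card = Module.finrank ℝ E) (hli : LinearIndependent ℝ fun v : F => (v : E)) :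
    ∃ φ : E → Module.Dual ℝ E, (∀ v ∈ F, ∀ u ∈ F, φ v u = if u = v then 1 else 0) ∧
      ∀ x, x = ∑ v ∈ F, φ v x • v := by
  let b := basisOfLinearIndependentOfCardEqFinrank' _ hli (by rw [← hcard, Fintype.card_coe])
  have hb : ∀ i, b i = (i : E) := fun i => by simp [b]
  refine ⟨fun v => if hv : v ∈ F then b.coord ⟨v, hv⟩ else 0, fun v hv u hu => ?_, fun x => ?_⟩
  · have h1 : b.coord ⟨v, hv⟩ (b ⟨u, hu⟩) = if u = v then 1 else 0 := by
      rw [Module.Basis.coord_apply, Module.Basis.repr_self, Finsupp.single_apply]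
      simp
    rw [hb] at h1
    simp only [dif_pos hv]
    exact h1
  · conv_lhs => rw [← b.sum_repr x]
    rw [← Finset.sum_coe_sort F]
    refine Finset.sum_congr rfl fun i _ => ?_
    simp only [hb, dif_pos i.2]
    rfl

/-- A regular subdivision of a full-dimensional cone is shellable, provided that each boundary
facet is opposite to a common apex `a`: move from the simplices in a generic direction close to
`a`. -/
theorem nonempty_shelling [FiniteDimensional ℝ E] (𝓕 : Finset (Finset E))
    (hcard : ∀ F ∈ 𝓕, F.card = Module.finrank ℝ E)
    (hli : ∀ F ∈ 𝓕, LinearIndependent ℝ fun v : F => (v : E)) (h : E → ℝ)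
    (hh : ∀ F ∈ 𝓕, ∃ L : Module.Dual ℝ E, (∀ v ∈ F, L v = h v) ∧
      ∀ F' ∈ 𝓕, ∀ v ∈ F', v ∉ F → L v < h v)
    (a : E) (ha : ∀ F ∈ 𝓕, F.Nonempty → a ∈ F)
    (hadj : ∀ F ∈ 𝓕, ∀ v ∈ F, v ≠ a → ∃ F' ∈ 𝓕, v ∉ F' ∧ ∀ u ∈ F, u ≠ v → u ∈ F') :
    Nonempty (Shelling 𝓕) := by
  classical
  choose! L hL hLlt using hh
  have hφ : ∀ F ∈ 𝓕, ∃ φ : E → Module.Dual ℝ E,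
      (∀ v ∈ F, ∀ u ∈ F, φ v u = if u = v then 1 else 0) ∧ ∀ x, x = ∑ v ∈ F, φ v x • v :=
    fun F hF => exists_dual_coordinates (hcard F hF) (hli F hF)
  choose! φ hφ1 hφ2 using hφ
  have hLF : ∀ F ∈ 𝓕, ∀ G : Module.Dual ℝ E, ∀ x, G x = ∑ v ∈ F, φ F v x * G v := by
    intro F hF G x
    conv_lhs => rw [hφ2 F hF x]
    simp
  have hsub : ∀ F ∈ 𝓕, ∀ F' ∈ 𝓕, F ⊆ F' → F = F' := fun F hF F' hF' hss =>
    Finset.eq_of_subset_of_card_le hss (by rw [hcard F hF, hcard F' hF'])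
  -- a generic direction
  obtain ⟨w', hw'⟩ := Module.Dual.exists_forall_ne_zero_of_forall_exists
    (fun q : {q : 𝓕 × 𝓕 // q.1 ≠ q.2} => L q.1.1 - L q.1.2) (by
      rintro ⟨⟨⟨F, hF⟩, ⟨F', hF'⟩⟩, hne⟩
      have : ¬ F ⊆ F' := fun hss => hne (Subtype.ext (hsub F hF F' hF' hss))
      obtain ⟨v, hv, hv'⟩ := Finset.not_subset.1 this
      refine ⟨v, ?_⟩
      have h1 := hL F hF v hv
      have h2 := hLlt F' hF' F hF v hv hv'
      simp only [LinearMap.sub_apply]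
      intro h0
      linarith)
  -- For small `δ` the coordinate of `a + δ • w'` at `a` stays positive in every simplex. So `a`
  -- never enters a restriction, and no neighbour across the facet opposite to `a` is needed.
  obtain ⟨δ, hδpos, hδ⟩ : ∃ δ : ℝ, 0 < δ ∧ ∀ F ∈ 𝓕, 0 < 1 + δ * φ F a w' := by
    have h1 : ∀ᶠ δ : ℝ in nhdsWithin 0 (Set.Ioi 0), ∀ F ∈ 𝓕, 0 < 1 + δ * φ F a w' := by
      refine Filter.Eventually.filter_mono nhdsWithin_le_nhds ?_
      rw [Filter.eventually_all_finset]
      intro F _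
      have hc : Continuous fun δ : ℝ => 1 + δ * φ F a w' := by fun_prop
      exact hc.continuousAt.eventually (lt_mem_nhds (by simp))
    obtain ⟨δ, h2, h3⟩ := (Filter.Eventually.and (eventually_mem_nhdsWithin (a := 0) (s := Set.Ioi (0 : ℝ))) h1).exists
    exact ⟨δ, h2, h3⟩
  let w : E := a + δ • w'
  have hLa : ∀ F ∈ 𝓕, ∀ F' ∈ 𝓕, F ≠ F' → L F a = L F' a := by
    intro F hF F' hF' hne
    -- An empty maximal simplex forces dimension `0`, and then `F = F'`.
    have hn : ∀ G ∈ 𝓕, G.Nonempty := by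
      intro G hG
      rw [Finset.nonempty_iff_ne_empty]
      rintro rfl
      have h0 := hcard _ hG
      rw [Finset.card_empty] at h0
      exact hne ((Finset.card_eq_zero.1 ((hcard F hF).trans h0.symm)).trans
        (Finset.card_eq_zero.1 ((hcard F' hF').trans h0.symm)).symm)
    rw [hL F hF a (ha F hF (hn F hF)), hL F' hF' a (ha F' hF' (hn F' hF'))]
  have hinj : ∀ F ∈ 𝓕, ∀ F' ∈ 𝓕, L F w = L F' w → F = F' := by
    intro F hF F' hF' heq
    by_contra hne
    have h1 := hw' ⟨⟨⟨F, hF⟩, ⟨F', hF'⟩⟩, fun h' => hne (congrArg Subtype.val h')⟩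
    simp only [LinearMap.sub_apply] at h1
    simp only [w, map_add, map_smul, smul_eq_mul, hLa F hF F' hF' hne] at heq
    have h2 : δ * (L F w' - L F' w') = 0 := by linarith
    exact h1 ((mul_eq_zero.1 h2).resolve_left hδpos.ne')
  have hapos : ∀ F ∈ 𝓕, a ∈ F → 0 < φ F a w := by
    intro F hF haF
    simp only [w, map_add, map_smul, smul_eq_mul, hφ1 F hF a haF a haF, if_true]
    exact hδ F hF
  -- The owner of `γ` is the maximal simplex around `γ` with the largest value at `w`. A larger
  -- simplex has fewer candidates, so the key is antitone.
  have hmax : ∀ γ : Finset E, (∃ F ∈ 𝓕, γ ⊆ F) → ∃ F ∈ 𝓕, γ ⊆ F ∧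
      ∀ F' ∈ 𝓕, γ ⊆ F' → L F' w ≤ L F w := by
    rintro γ ⟨F, hF, hγ⟩
    obtain ⟨G, hG, hGmax⟩ := (𝓕.filter (γ ⊆ ·)).exists_max_image (fun F => L F w)
      ⟨F, Finset.mem_filter.2 ⟨hF, hγ⟩⟩
    obtain ⟨hG1, hG2⟩ := Finset.mem_filter.1 hG
    exact ⟨G, hG1, hG2, fun F' hF' hγ' => hGmax F' (Finset.mem_filter.2 ⟨hF', hγ'⟩)⟩
  choose! owner hmem hsubset hle using hmax
  let key : Finset E → ℕ := fun F => (𝓕.filter fun G => L G w < L F w).card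
  have hkey : ∀ F F' : Finset E, L F w ≤ L F' w → key F ≤ key F' := fun F F' hlt =>
    Finset.card_le_card fun G hG => by
      obtain ⟨h1, h2⟩ := Finset.mem_filter.1 hG
      exact Finset.mem_filter.2 ⟨h1, h2.trans_le hlt⟩
  have hkey_lt : ∀ F ∈ 𝓕, ∀ F' : Finset E, L F w < L F' w → key F < key F' := by
    intro F hF F' hlt
    refine Finset.card_lt_card ((Finset.ssubset_iff_of_subset ?_).2 ⟨F, ?_, ?_⟩)
    · intro G hG
      obtain ⟨h1, h2⟩ := Finset.mem_filter.1 hG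
      exact Finset.mem_filter.2 ⟨h1, h2.trans hlt⟩
    · exact Finset.mem_filter.2 ⟨hF, hlt⟩
    · simp
  refine ⟨{
    key := key
    owner := owner
    restriction := fun F => F.filter fun v => φ F v w < 0
    owner_mem := hmem
    subset_owner := hsubset
    restriction_subset := ?_
    owner_eq := ?_
    key_owner_le := ?_
    key_injOn := ?_ }⟩
  -- If a vertex `v ∉ γ` had negative coordinate, the neighbour `F'` across the facet opposite to
  -- `v` would still contain `γ`. The values at `w` of the two linear functions differ by that
  -- coordinate times `L F' v - h v < 0`, so `F'` would have the larger value.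
  · intro γ hγ v hv
    obtain ⟨hvF, hneg⟩ := Finset.mem_filter.1 hv
    by_contra hvγ
    have hF := hmem γ hγ
    have hva : v ≠ a := by
      rintro rfl
      exact absurd (hapos _ hF hvF) (not_lt.2 hneg.le)
    obtain ⟨F', hF', hvF', hsubF'⟩ := hadj _ hF v hvF hva
    have h1 := hle γ hγ F' hF' fun u hu =>
      hsubF' u (hsubset γ hγ hu) fun h' => hvγ (h' ▸ hu)
    rw [hLF _ hF (L F') w, hLF _ hF (L (owner γ)) w, ← sub_nonneg, ← Finset.sum_sub_distrib,
      Finset.sum_eq_single v] at h1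
    · rw [hL _ hF v hvF] at h1
      have h2 := hLlt F' hF' _ hF v hvF hvF'
      have h3 := mul_pos_of_neg_of_neg hneg (sub_neg.2 h2)
      linarith
    · intro u hu huv
      rw [hL _ hF u hu, hL F' hF' u (hsubF' u hu huv), sub_self]
    · exact fun h' => absurd hvF h'
  -- Compare the owner with `F` in the coordinates of `w` on `F`: common vertices cancel, and the
  -- other vertices are outside `γ`, so their coordinates are nonnegative and `F` wins. Genericity
  -- turns equality of values into equality of simplices.
  · intro F hF γ hR hγF
    have hγ : ∃ F ∈ 𝓕, γ ⊆ F := ⟨F, hF, hγF⟩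
    have hG := hmem γ hγ
    refine hinj _ hG F hF (le_antisymm ?_ (hle γ hγ F hF hγF))
    rw [hLF F hF (L F) w, hLF F hF (L (owner γ)) w]
    refine Finset.sum_le_sum fun u hu => ?_
    rw [hL F hF u hu]
    by_cases huG : u ∈ owner γ
    · rw [hL _ hG u huG]
    · refine mul_le_mul_of_nonneg_left (hLlt _ hG F hF u hu huG).le ?_
      by_contra hneg
      exact huG (hsubset γ hγ (hR (Finset.mem_filter.2 ⟨hu, not_le.1 hneg⟩)))
  · intro γ γ' hss hγ'
    obtain ⟨F, hF, hγF⟩ := hγ'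
    exact hkey _ _ (hle γ ⟨F, hF, hss.trans hγF⟩ _ (hmem γ' ⟨F, hF, hγF⟩)
      (hss.trans (hsubset γ' ⟨F, hF, hγF⟩)))
  · intro F hF F' hF' heq
    refine hinj F hF F' hF' ?_
    rcases lt_trichotomy (L F w) (L F' w) with hlt | heq' | hlt
    · exact absurd heq (hkey_lt F hF F' hlt).ne
    · exact heq'
    · exact absurd heq (hkey_lt F' hF' F hlt).ne'

end Subdivision

/-! ### Cochains in the exterior algebra and the homotopy on an interval -/

section Cochains

variable {N : Type*} [AddCommGroup N]

open Classical in
/-- The differential of the Ishida complex in terms of cochains with values in the exterior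
algebra. -/
def coboundary (x : Finset (NR N) → ExteriorAlgebra ℂ (MC N)) (ν : Finset (NR N)) :
    ExteriorAlgebra ℂ (MC N) :=
  ∑ v ∈ ν, contract v (x (ν.erase v))

/-- Contractions anticommute, so the two orders of removing a pair of vertices cancel. -/
theorem coboundary_coboundary (x : Finset (NR N) → ExteriorAlgebra ℂ (MC N))
    (ν : Finset (NR N)) : coboundary (coboundary x) ν = 0 := by
  classical
  simp only [coboundary, map_sum]
  rw [Finset.sum_sigma']
  refine Finset.sum_involution (fun a _ => ⟨a.2, a.1⟩) ?_ ?_ ?_ ?_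
  · rintro ⟨v, w⟩ -
    dsimp only
    rw [contract_comm, Finset.erase_right_comm]
    exact neg_add_cancel _
  · rintro ⟨v, w⟩ hvw - heq
    have h1 : w = v := congrArg (fun a => a.1) heq
    exact Finset.ne_of_mem_erase (Finset.mem_sigma.1 hvw).2 h1
  · rintro ⟨v, w⟩ hvw
    obtain ⟨hv, hw⟩ := Finset.mem_sigma.1 hvw
    exact Finset.mem_sigma.2 ⟨Finset.mem_of_mem_erase hw,
      Finset.mem_erase.2 ⟨(Finset.ne_of_mem_erase hw).symm, hv⟩⟩
  · rintro ⟨v, w⟩ -; rfl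

theorem coboundary_sub (x y : Finset (NR N) → ExteriorAlgebra ℂ (MC N)) (ν : Finset (NR N)) :
    coboundary (x - y) ν = coboundary x ν - coboundary y ν := by
  simp [coboundary, Finset.sum_sub_distrib]

theorem coboundary_add (x y : Finset (NR N) → ExteriorAlgebra ℂ (MC N)) (ν : Finset (NR N)) :
    coboundary (x + y) ν = coboundary x ν + coboundary y ν := by
  simp [coboundary, Finset.sum_add_distrib]

open Classical in
theorem coboundary_mem_extPerp {p i : ℕ} (hip : i ≤ p)
    {x : Finset (NR N) → ExteriorAlgebra ℂ (MC N)} {ν : Finset (NR N)} (hν : ν.card = i)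
    (hx : ∀ v ∈ ν, x (ν.erase v) ∈ extPerp p (ν.erase v)) : coboundary x ν ∈ extPerp p ν :=
  sum_mem fun v hv => contract_mem_extPerp hv rfl (hν ▸ hip) _ (hx v hv)

/-- `e` is the basis of `M_ℂ` dual to the vectors in `F`. -/
structure IsDualBasis (F : Finset (NR N)) (e : NR N → MC N) : Prop where
  eval_self : ∀ v ∈ F, eval v (e v) = 1
  eval_ne : ∀ v ∈ F, ∀ u ∈ F, u ≠ v → eval u (e v) = 0
  sum_eval : ∀ x : MC N, x = ∑ v ∈ F, eval v x • e v

namespace IsDualBasis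

variable {F : Finset (NR N)} {e : NR N → MC N}

theorem mem_perp (he : IsDualBasis F e) {γ : Finset (NR N)} (hγ : γ ⊆ F) {v : NR N} (hv : v ∈ F)
    (hvγ : v ∉ γ) : e v ∈ perp γ :=
  ToricIshida.mem_perp.2 fun u hu => he.eval_ne v hv u (hγ hu) fun h => hvγ (h ▸ hu)

open Classical in
/-- Euler's formula: `∑ e_v ∧ ι_v` multiplies by the degree. -/
theorem sum_mul_contract (he : IsDualBasis F e) {γ : Finset (NR N)} (hγ : γ ⊆ F) (k : ℕ) :
    ∀ x ∈ ((perp γ).map (ExteriorAlgebra.ι ℂ)) ^ k,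
      ∑ v ∈ F \ γ, ExteriorAlgebra.ι ℂ (e v) * contract v x = (k : ℂ) • x := by
  induction k with
  | zero =>
    intro x hx
    rw [pow_zero, Submodule.mem_one] at hx
    obtain ⟨c, rfl⟩ := hx
    rw [Nat.cast_zero, zero_smul]
    refine Finset.sum_eq_zero fun v _ => ?_
    rw [contract, CliffordAlgebra.contractLeft_algebraMap (0 : QuadraticForm ℂ (MC N)) (eval v) c,
      mul_zero]
  | succ k ih =>
    intro x hx
    rw [pow_succ'] at hx
    induction hx using Submodule.mul_induction_on' with
    | mem_mul_mem a ha b hb =>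
      obtain ⟨a, ha, rfl⟩ := ha
      have h1 : a = ∑ v ∈ F \ γ, eval v a • e v := by
        conv_lhs => rw [he.sum_eval a]
        rw [← Finset.sum_sdiff hγ, Finset.sum_eq_zero (s := γ), add_zero]
        intro v hv
        rw [ToricIshida.mem_perp.1 ha v hv, zero_smul]
      -- Contraction followed by wedging with `e v` is a derivation, which makes the induction on
      -- the degree work.
      have h2 : ∀ v, ExteriorAlgebra.ι ℂ (e v) * contract v (ExteriorAlgebra.ι ℂ a * b) =
          ExteriorAlgebra.ι ℂ (eval v a • e v) * b +
            ExteriorAlgebra.ι ℂ a * (ExteriorAlgebra.ι ℂ (e v) * contract v b) := by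
        intro v
        rw [contract_ι_mul, mul_sub, mul_smul_comm, map_smul, smul_mul_assoc, ← mul_assoc,
          ← mul_assoc, eq_neg_of_add_eq_zero_left (ExteriorAlgebra.ι_add_mul_swap (e v) a),
          neg_mul, sub_neg_eq_add]
      rw [Finset.sum_congr rfl fun v _ => h2 v, Finset.sum_add_distrib, ← Finset.sum_mul,
        ← map_sum, ← h1, ← Finset.mul_sum, ih b hb, mul_smul_comm]
      push_cast
      rw [add_smul, one_smul, add_comm]
    | add x _ y _ hx hy => simp only [map_add, mul_add, Finset.sum_add_distrib, hx, hy, smul_add]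

end IsDualBasis

variable {𝓕 : Finset (Finset (NR N))}

open Classical in
/-- One step of the filtration by the shelling order: a cocycle of degree `i < p` that is supported
on blocks with `key ≤ k` is homologous to one supported on blocks with `key < k`. -/
theorem Shelling.exists_reduction (sh : Shelling 𝓕) (e : Finset (NR N) → NR N → MC N)
    (he : ∀ F ∈ 𝓕, IsDualBasis F (e F)) {p i : ℕ} (hip : i < p) (k : ℕ)
    (x : Finset (NR N) → ExteriorAlgebra ℂ (MC N))
    (hx : ∀ γ, (∃ F ∈ 𝓕, γ ⊆ F) → γ.card = i → x γ ∈ extPerp p γ)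
    (hdx : ∀ ν, (∃ F ∈ 𝓕, ν ⊆ F) → ν.card = i + 1 → coboundary x ν = 0)
    (hk : ∀ γ, (∃ F ∈ 𝓕, γ ⊆ F) → γ.card = i → k < sh.key (sh.owner γ) → x γ = 0) :
    ∃ y : Finset (NR N) → ExteriorAlgebra ℂ (MC N),
      (∀ γ, (∃ F ∈ 𝓕, γ ⊆ F) → γ.card + 1 = i → y γ ∈ extPerp p γ) ∧
      ∀ ν, (∃ F ∈ 𝓕, ν ⊆ F) → ν.card = i → k ≤ sh.key (sh.owner ν) →
        x ν - coboundary y ν = 0 := by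
  -- This is the homotopy `h` of the block with key `k`, divided by the scalar `p - |R|`, and
  -- extended by zero to the other blocks.
  let y : Finset (NR N) → ExteriorAlgebra ℂ (MC N) := fun γ =>
    if sh.key (sh.owner γ) = k then
      ((p : ℂ) - (sh.restriction (sh.owner γ)).card)⁻¹ •
        ∑ v ∈ sh.owner γ \ γ, ExteriorAlgebra.ι ℂ (e (sh.owner γ) v) * x (insert v γ)
    else 0
  refine ⟨y, fun γ hγ hcard => ?_, fun ν hν hcard hkν => ?_⟩
  · simp only [y]
    split_ifs
    · have hF := sh.owner_mem γ hγ
      have hγF := sh.subset_owner γ hγ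
      refine Submodule.smul_mem _ _ (sum_mem fun v hv => ?_)
      obtain ⟨hvF, hvγ⟩ := Finset.mem_sdiff.1 hv
      have hc : (insert v γ).card = γ.card + 1 := Finset.card_insert_of_notMem hvγ
      have h1 := hx (insert v γ) ⟨_, hF, Finset.insert_subset hvF hγF⟩ (by omega)
      rw [extPerp_of_le (by omega)] at h1 ⊢
      rw [show p - γ.card = p - (insert v γ).card + 1 by omega, pow_succ']
      refine Submodule.mul_mem_mul ⟨_, (he _ hF).mem_perp hγF hvF hvγ, rfl⟩ ?_
      refine pow_le_pow_left' (Submodule.map_mono fun u hu => ?_) _ h1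
      exact mem_perp.2 fun a ha => mem_perp.1 hu a (Finset.mem_insert_of_mem ha)
    · exact zero_mem _
  · rcases hkν.lt_or_eq with hlt | heq
    · rw [hk ν hν hcard hlt, zero_sub, neg_eq_zero]
      refine Finset.sum_eq_zero fun v hv => ?_
      have h1 := sh.key_owner_le (ν.erase v) ν (Finset.erase_subset v ν) hν
      simp only [y]
      rw [if_neg (by omega), map_zero]
    · set F := sh.owner ν with hFdef
      have hF : F ∈ 𝓕 := sh.owner_mem ν hν
      have hνF : ν ⊆ F := sh.subset_owner ν hν
      have hRν : sh.restriction F ⊆ ν := sh.restriction_subset ν hν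
      set R := sh.restriction F
      have hcR : R.card ≤ ν.card := Finset.card_le_card hRν
      -- Here the degree below `p` is used: `|R| ≤ |ν| = i < p`.
      have hs : ((p : ℂ) - R.card) ≠ 0 := by
        rw [sub_ne_zero]
        exact_mod_cast (by omega : p ≠ R.card)
      have hface : ∀ u, ∃ G ∈ 𝓕, ν.erase u ⊆ G :=
        fun u => ⟨F, hF, (Finset.erase_subset u ν).trans hνF⟩
      have howner : ∀ u ∈ ν, u ∉ R → sh.owner (ν.erase u) = F := fun u _ huR =>
        sh.owner_eq F hF _ (fun a ha => Finset.mem_erase.2 ⟨fun h => huR (h ▸ ha), hRν ha⟩)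
          ((Finset.erase_subset u ν).trans hνF)
      -- Removing a vertex of the restriction leaves the block of `F`; since keys are distinct, `y`
      -- vanishes there.
      have hyR : ∀ u ∈ R, y (ν.erase u) = 0 := fun u hu => by
        simp only [y]
        refine if_neg fun hkey => ?_
        have h1 := sh.key_injOn (sh.owner_mem _ (hface u)) hF (hkey.trans heq)
        have h2 := sh.restriction_subset _ (hface u)
        rw [h1] at h2
        exact Finset.notMem_erase u ν (h2 hu)
      have hy : ∀ u ∈ ν, u ∉ R → y (ν.erase u) = ((p : ℂ) - R.card)⁻¹ •
          ∑ v ∈ F \ ν.erase u, ExteriorAlgebra.ι ℂ (e F v) * x (insert v (ν.erase u)) := by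
        intro u hu huR
        simp only [y]
        rw [howner u hu huR, if_pos heq.symm]
      have hxν : x ν ∈ ((perp ν).map (ExteriorAlgebra.ι ℂ)) ^ (p - ν.card) := by
        rw [← extPerp_of_le (by omega)]; exact hx ν hν hcard
      have hterm : ∀ u ∈ ν \ R, contract u (y (ν.erase u)) = ((p : ℂ) - R.card)⁻¹ •
          (x ν - ∑ v ∈ F \ ν, ExteriorAlgebra.ι ℂ (e F v) *
            contract u (x ((insert v ν).erase u))) := by
        intro u hu
        obtain ⟨hu, huR⟩ := Finset.mem_sdiff.1 hu
        rw [hy u hu huR, map_smul, map_sum]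
        congr 1
        have hset : F \ ν.erase u = insert u (F \ ν) := by
          ext a
          simp only [Finset.mem_sdiff, Finset.mem_erase, Finset.mem_insert]
          have := @hνF a
          by_cases hau : a = u
          · subst hau; simp [hνF hu]
          · simp [hau]
        rw [hset, Finset.sum_insert (fun h => (Finset.mem_sdiff.1 h).2 hu), Finset.insert_erase hu,
          contract_ι_mul, (he F hF).eval_self u (hνF hu), one_smul,
          contract_pow_perp hu _ _ hxν, mul_zero, sub_zero, sub_eq_add_neg,
          ← Finset.sum_neg_distrib]
        congr 1
        refine Finset.sum_congr rfl fun v hv => ?_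
        obtain ⟨hvF, hvν⟩ := Finset.mem_sdiff.1 hv
        have huv : u ≠ v := fun h => hvν (h ▸ hu)
        rw [contract_ι_mul, (he F hF).eval_ne v hvF u (hνF hu) huv, zero_smul, zero_sub,
          Finset.erase_insert_of_ne huv.symm]
      -- The cocycle condition at `ν ∪ {v}`: removing `u ∈ R` leads to a block of strictly larger
      -- key, where `x` is zero.
      have hcocycle : ∀ v ∈ F \ ν, ∑ u ∈ ν \ R, contract u (x ((insert v ν).erase u)) =
          -contract v (x ν) := by
        intro v hv
        obtain ⟨hvF, hvν⟩ := Finset.mem_sdiff.1 hv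
        have hins : insert v ν ⊆ F := Finset.insert_subset hvF hνF
        have h1 := hdx (insert v ν) ⟨F, hF, hins⟩ (by rw [Finset.card_insert_of_notMem hvν, hcard])
        rw [coboundary, Finset.sum_insert hvν, Finset.erase_insert hvν,
          ← Finset.sum_sdiff hRν, Finset.sum_eq_zero (s := R), add_zero] at h1
        · exact eq_neg_of_add_eq_zero_right h1
        · intro u hu
          have hG : ∃ G ∈ 𝓕, (insert v ν).erase u ⊆ G :=
            ⟨F, hF, (Finset.erase_subset _ _).trans hins⟩
          have howner' : sh.owner (insert v ν) = F :=
            sh.owner_eq F hF _ (hRν.trans (Finset.subset_insert v ν)) hins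
          have hle := sh.key_owner_le ((insert v ν).erase u) (insert v ν)
            (Finset.erase_subset _ _) ⟨F, hF, hins⟩
          rw [howner'] at hle
          have hne : sh.key F ≠ sh.key (sh.owner ((insert v ν).erase u)) := fun hkey => by
            have h2 := sh.key_injOn hF (sh.owner_mem _ hG) hkey
            have h3 := sh.restriction_subset _ hG
            rw [← h2] at h3
            exact Finset.notMem_erase u _ (h3 hu)
          rw [hk _ hG (by
            rw [Finset.card_erase_of_mem (Finset.mem_insert_of_mem (hRν hu)),
              Finset.card_insert_of_notMem hvν]
            omega) (by omega), map_zero]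
      have heuler := (he F hF).sum_mul_contract hνF _ _ hxν
      -- The terms `x ν` number `|ν| - |R|`, and the cocycle relation followed by Euler's formula
      -- adds `(p - |ν|) • x ν`.
      have hsum : coboundary y ν = ((p : ℂ) - R.card)⁻¹ • (((p : ℂ) - R.card) • x ν) := by
        rw [coboundary, ← Finset.sum_sdiff hRν, Finset.sum_eq_zero (s := R), add_zero,
          Finset.sum_congr rfl hterm, ← Finset.smul_sum, Finset.sum_sub_distrib,
          Finset.sum_comm, Finset.sum_const, Finset.card_sdiff_of_subset hRν]
        · congr 1
          rw [Finset.sum_congr rfl fun v hv => by rw [← Finset.mul_sum, hcocycle v hv, mul_neg],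
            Finset.sum_neg_distrib, heuler, sub_neg_eq_add, ← Nat.cast_smul_eq_nsmul ℂ, ← add_smul,
            Nat.cast_sub hcR, Nat.cast_sub (by omega)]
          congr 1
          ring
        · intro u hu
          rw [hyR u hu, map_zero]
      rw [hsum, inv_smul_smul₀ hs, sub_self]

open Classical in
theorem Shelling.exists_primitive (sh : Shelling 𝓕) (e : Finset (NR N) → NR N → MC N)
    (he : ∀ F ∈ 𝓕, IsDualBasis F (e F)) {p i : ℕ} (hip : i < p)
    (x : Finset (NR N) → ExteriorAlgebra ℂ (MC N))
    (hx : ∀ γ, (∃ F ∈ 𝓕, γ ⊆ F) → γ.card = i → x γ ∈ extPerp p γ)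
    (hdx : ∀ ν, (∃ F ∈ 𝓕, ν ⊆ F) → ν.card = i + 1 → coboundary x ν = 0) :
    ∃ y : Finset (NR N) → ExteriorAlgebra ℂ (MC N),
      (∀ γ, (∃ F ∈ 𝓕, γ ⊆ F) → γ.card + 1 = i → y γ ∈ extPerp p γ) ∧
      ∀ ν, (∃ F ∈ 𝓕, ν ⊆ F) → ν.card = i → coboundary y ν = x ν := by
  suffices key : ∀ (k : ℕ) (x : Finset (NR N) → ExteriorAlgebra ℂ (MC N)),
      (∀ γ, (∃ F ∈ 𝓕, γ ⊆ F) → γ.card = i → x γ ∈ extPerp p γ) →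
      (∀ ν, (∃ F ∈ 𝓕, ν ⊆ F) → ν.card = i + 1 → coboundary x ν = 0) →
      (∀ γ, (∃ F ∈ 𝓕, γ ⊆ F) → γ.card = i → k ≤ sh.key (sh.owner γ) → x γ = 0) →
      ∃ y : Finset (NR N) → ExteriorAlgebra ℂ (MC N),
        (∀ γ, (∃ F ∈ 𝓕, γ ⊆ F) → γ.card + 1 = i → y γ ∈ extPerp p γ) ∧
        ∀ ν, (∃ F ∈ 𝓕, ν ⊆ F) → ν.card = i → coboundary y ν = x ν by
    -- Beyond the largest key the support condition is vacuous.
    refine key (𝓕.sup sh.key + 1) x hx hdx fun γ hγ _ hle => ?_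
    have := Finset.le_sup (f := sh.key) (sh.owner_mem γ hγ)
    omega
  intro k
  induction k with
  | zero =>
    intro x _ _ h0
    refine ⟨0, fun γ _ _ => zero_mem _, fun ν hν hcard => ?_⟩
    rw [h0 ν hν hcard (Nat.zero_le _)]
    simp [coboundary]
  | succ k ih =>
    intro x hx hdx hk
    obtain ⟨y, hy, hxy⟩ := sh.exists_reduction e he hip k x hx hdx fun γ hγ hc hlt =>
      hk γ hγ hc hlt
    have hmem : ∀ ν, (∃ F ∈ 𝓕, ν ⊆ F) → ν.card = i → coboundary y ν ∈ extPerp p ν := by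
      rintro ν ⟨F, hF, hνF⟩ hcard
      refine coboundary_mem_extPerp hip.le hcard fun v hv => hy _
        ⟨F, hF, (Finset.erase_subset v ν).trans hνF⟩ ?_
      rw [Finset.card_erase_add_one hv, hcard]
    obtain ⟨y', hy', hxy'⟩ := ih (x - coboundary y)
      (fun γ hγ hcard => sub_mem (hx γ hγ hcard) (hmem γ hγ hcard))
      (fun ν hν hcard => by
        rw [coboundary_sub, hdx ν hν hcard, coboundary_coboundary, sub_zero])
      hxy
    refine ⟨y + y', fun γ hγ hc => add_mem (hy γ hγ hc) (hy' γ hγ hc), fun ν hν hc => ?_⟩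
    rw [coboundary_add, hxy' ν hν hc, Pi.sub_apply, add_sub_cancel]

end Cochains

/-! ### Complexified dual bases -/

section DualBasis

variable (N : Type*) [AddCommGroup N]

/-- The map `M → M_ℂ`. -/
def latticeToMC : Module.Dual ℤ N →+ MC N :=
  (TensorProduct.mk ℤ ℂ (Module.Dual ℤ N) 1).toAddMonoidHom

variable {N}

theorem eval_latticeToMC (v : NR N) (m : Module.Dual ℤ N) :
    eval v (latticeToMC N m) = ((m.baseChange ℝ v : ℝ) : ℂ) :=
  (eval_tmul v 1 m).trans (one_mul _)

theorem MC_induction {P : MC N → Prop} (hadd : ∀ x y, P x → P y → P (x + y))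
    (hsmul : ∀ (z : ℂ) (m : Module.Dual ℤ N), P (z • latticeToMC N m)) (x : MC N) : P x := by
  refine TensorProduct.induction_on (motive := P) x ?_ ?_ hadd
  · have := hsmul 0 0
    rw [zero_smul] at this
    exact this
  · intro z m
    have h1 : (z • latticeToMC N m : MC N) = (z • ((1 : ℂ) ⊗ₜ[ℤ] m) : ℂ ⊗[ℤ] Module.Dual ℤ N) :=
      rfl
    have h2 := hsmul z m
    rw [h1, TensorProduct.smul_tmul', smul_eq_mul, mul_one] at h2
    exact h2

variable [Module.Free ℤ N] [Module.Finite ℤ N]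

/-- The complexification `Hom_ℝ(N_ℝ, ℝ) → M_ℂ` of a real functional. -/
def functionalToMC (φ : Module.Dual ℝ (NR N)) : MC N :=
  ∑ k, ((φ (1 ⊗ₜ[ℤ] Module.Free.chooseBasis ℤ N k) : ℝ) : ℂ) •
    latticeToMC N ((Module.Free.chooseBasis ℤ N).coord k)

theorem eval_functionalToMC (φ : Module.Dual ℝ (NR N)) (v : NR N) :
    eval v (functionalToMC φ) = ((φ v : ℝ) : ℂ) := by
  let b := Module.Free.chooseBasis ℤ N
  have h : φ = ∑ k, φ (1 ⊗ₜ[ℤ] b k) • Module.Dual.baseChange ℝ (b.coord k) := by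
    refine TensorProduct.AlgebraTensorModule.curry_injective ?_
    ext x
    have h1 : φ (1 ⊗ₜ[ℤ] x) = ∑ k, (b.repr x k : ℝ) • φ (1 ⊗ₜ[ℤ] b k) := by
      conv_lhs => rw [← b.sum_repr x]
      rw [TensorProduct.tmul_sum, map_sum]
      refine Finset.sum_congr rfl fun k _ => ?_
      rw [TensorProduct.tmul_smul, map_zsmul, zsmul_eq_mul, smul_eq_mul]
    simp [h1, mul_comm]
  simp only [functionalToMC, map_sum, map_smul, eval_latticeToMC, smul_eq_mul]
  conv_rhs => rw [h]
  simp [b]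

theorem functionalToMC_baseChange (m : Module.Dual ℤ N) :
    functionalToMC (m.baseChange ℝ) = latticeToMC N m := by
  let b := Module.Free.chooseBasis ℤ N
  have h : m = ∑ k, m (b k) • b.coord k := by
    refine b.ext fun j => ?_
    simp
  conv_rhs => rw [h]
  rw [functionalToMC, map_sum]
  refine Finset.sum_congr rfl fun k _ => ?_
  rw [map_zsmul, ← Int.cast_smul_eq_zsmul ℂ]
  congr 1
  simp [b]

theorem functionalToMC_sum {ι : Type*} (s : Finset ι) (c : ι → ℝ)
    (φ : ι → Module.Dual ℝ (NR N)) :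
    functionalToMC (∑ i ∈ s, c i • φ i) = ∑ i ∈ s, (c i : ℂ) • functionalToMC (φ i) := by
  simp only [functionalToMC, Finset.smul_sum, smul_smul]
  rw [Finset.sum_comm]
  refine Finset.sum_congr rfl fun k _ => ?_
  rw [← Finset.sum_smul]
  congr 1
  simp

/-- The real coordinate functionals are complexified; the expansion of a general element is linear,
so it suffices to check it on multiples of lattice functionals. -/
theorem exists_isDualBasis {F : Finset (NR N)} (hcard : F.card = Module.finrank ℝ (NR N))
    (hli : LinearIndependent ℝ fun v : F => (v : NR N)) : ∃ e, IsDualBasis F e := by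
  classical
  obtain ⟨φ, h1, h2⟩ := exists_dual_coordinates hcard hli
  refine ⟨fun v => functionalToMC (φ v), fun v hv => ?_, fun v hv u hu hne => ?_, fun x => ?_⟩
  · rw [eval_functionalToMC, h1 v hv v hv]; simp
  · rw [eval_functionalToMC, h1 v hv u hu]; simp [hne]
  · induction x using MC_induction with
    | hadd x y hx hy =>
      simp only [map_add, add_smul, Finset.sum_add_distrib]
      rw [← hx, ← hy]
    | hsmul z m =>
      have h3 : m.baseChange ℝ = ∑ v ∈ F, m.baseChange ℝ v • φ v := by
        refine LinearMap.ext fun x => ?_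
        conv_lhs => rw [h2 x]
        simp [mul_comm]
      simp only [map_smul, eval_latticeToMC, smul_eq_mul, mul_smul, ← Finset.smul_sum]
      rw [← functionalToMC_sum, ← h3, functionalToMC_baseChange]

end DualBasis

/-! ### Trivialization of the lines -/

section Lines

variable {N : Type*} [AddCommGroup N]

/-- Evaluation at `v` on the line `M_ℂ / v^⊥`. -/
def rayEval (v : NR N) : rayLine v →ₗ[ℂ] ℂ :=
  (perp {v}).liftQ (eval v) fun _ hu => mem_perp.1 hu v (Finset.mem_singleton_self v)

theorem rayEval_smul_rayGen (v : NR N) (y : rayLine v) : rayEval v y • rayGen v = y := by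
  obtain ⟨u, rfl⟩ := (perp {v}).mkQ_surjective y
  rw [mkQ_eq_smul_rayGen v u]
  by_cases h : eval v u = 0
  · rw [h, zero_smul, map_zero, zero_smul]
  · have h1 : rayEval v (rayGen v) = 1 := by
      have h2 := congrArg (rayEval v) (mkQ_eq_smul_rayGen v u)
      rw [map_smul] at h2
      have h3 : rayEval v ((perp {v}).mkQ u) = eval v u := rfl
      rw [h3, smul_eq_mul] at h2
      exact (mul_left_cancel₀ h (by rw [mul_one]; exact h2)).symm
    rw [map_smul, h1, smul_eq_mul, mul_one]

theorem rayEval_rayGen {v : NR N} (h : ∃ e : MC N, eval v e = 1) : rayEval v (rayGen v) = 1 := by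
  obtain ⟨e, he⟩ := h
  have h1 := mkQ_eq_smul_rayGen v e
  rw [he, one_smul] at h1
  rw [← h1]
  exact he

/-- The trivialization of `⨂ M_ℂ / v^⊥` given by evaluation. -/
def lineEval (γ : Finset (NR N)) : lineProduct γ →ₗ[ℂ] ℂ :=
  show (⨂[ℂ] v : γ, rayLine (v : NR N)) →ₗ[ℂ] ℂ from
    PiTensorProduct.lift ((MultilinearMap.mkPiAlgebra ℂ γ ℂ).compLinearMap
      fun v => rayEval (v : NR N))

theorem lineEval_pureTensor {γ : Finset (NR N)} (y : (v : γ) → rayLine (v : NR N)) :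
    lineEval γ (pureTensor y) = ∏ v : γ, rayEval (v : NR N) (y v) :=
  (PiTensorProduct.lift.tprod (R := ℂ) (s := fun v : γ => rayLine (v : NR N)) y).trans (by simp)

/-- The generator of `⨂ M_ℂ / v^⊥`. -/
def lineGen (γ : Finset (NR N)) : lineProduct γ :=
  pureTensor fun v => rayGen (v : NR N)

theorem lineEval_smul_lineGen {γ : Finset (NR N)} (t : lineProduct γ) :
    lineEval γ t • lineGen γ = t := by
  suffices (lineEval γ).smulRight (lineGen γ) = LinearMap.id from LinearMap.congr_fun this t
  refine lineProduct_ext fun y => ?_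
  rw [LinearMap.smulRight_apply, lineEval_pureTensor, LinearMap.id_apply]
  have h := MultilinearMap.map_smul_univ (PiTensorProduct.tprod ℂ)
    (fun v : γ => rayEval (v : NR N) (y v)) fun v : γ => rayGen (v : NR N)
  simp only [rayEval_smul_rayGen] at h
  exact h.symm

theorem lineEval_lineGen {γ : Finset (NR N)} (h : ∀ v ∈ γ, ∃ e : MC N, eval v e = 1) :
    lineEval γ (lineGen γ) = 1 := by
  rw [lineGen, lineEval_pureTensor]
  exact Finset.prod_eq_one fun v _ => rayEval_rayGen (h v v.2)

theorem lineEval_insertGen {μ ν : Finset (NR N)} (hμν : μ ⊆ ν)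
    (h : ∀ v ∈ ν, ∃ e : MC N, eval v e = 1) (t : lineProduct μ) :
    lineEval ν (insertGen hμν t) = lineEval μ t := by
  classical
  suffices lineEval ν ∘ₗ insertGen hμν = lineEval μ from LinearMap.congr_fun this t
  refine lineProduct_ext fun y => ?_
  rw [LinearMap.comp_apply, insertGen_pureTensor, lineEval_pureTensor, lineEval_pureTensor]
  let G : NR N → ℂ := fun v => if hv : v ∈ μ then rayEval v (y ⟨v, hv⟩) else 1
  have h1 : ∀ v : ν, rayEval (v : NR N) (if hv : (v : NR N) ∈ μ then y ⟨v, hv⟩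
      else rayGen (v : NR N)) = G v := by
    intro v
    by_cases hv : (v : NR N) ∈ μ
    · simp only [G, dif_pos hv]
    · simp only [G, dif_neg hv]
      exact rayEval_rayGen (h v v.2)
  have h2 : ∀ v : μ, rayEval (v : NR N) (y v) = G v := fun v => by simp only [G, dif_pos v.2]
  rw [Finset.prod_congr rfl fun v _ => h1 v, Finset.prod_congr rfl fun v _ => h2 v,
    Finset.prod_coe_sort ν G, Finset.prod_coe_sort μ G]
  exact (Finset.prod_subset hμν fun v _ hv => dif_neg hv).symm

/-- The isomorphism `V_γ^p ≅ ⋀^{p-r} γ^⊥` given by evaluation on the lines. -/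
def toExtPerp (p : ℕ) (γ : Finset (NR N)) : V p γ →ₗ[ℂ] extPerp p γ :=
  show extPerp p γ ⊗[ℂ] lineProduct γ →ₗ[ℂ] extPerp p γ from
    (TensorProduct.rid ℂ (extPerp p γ)).toLinearMap ∘ₗ TensorProduct.map LinearMap.id (lineEval γ)

theorem toExtPerp_tmul {p : ℕ} {γ : Finset (NR N)} (x : extPerp p γ) (t : lineProduct γ) :
    toExtPerp p γ (V.tmul x t) = lineEval γ t • x :=
  rfl

theorem tmul_toExtPerp {p : ℕ} {γ : Finset (NR N)} (z : V p γ) :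
    V.tmul (toExtPerp p γ z) (lineGen γ) = z := by
  refine TensorProduct.induction_on
    (motive := fun z : V p γ => V.tmul (toExtPerp p γ z) (lineGen γ) = z) z ?_ ?_ ?_
  · exact (congrArg (fun x => V.tmul x (lineGen γ)) (map_zero (toExtPerp p γ))).trans
      (TensorProduct.zero_tmul _ _)
  · intro x t
    change V.tmul (toExtPerp p γ (V.tmul x t)) (lineGen γ) = V.tmul x t
    rw [toExtPerp_tmul]
    conv_rhs => rw [← lineEval_smul_lineGen t]
    exact TensorProduct.smul_tmul _ _ _
  · intro x y hx hy
    have h1 : V.tmul (toExtPerp p γ (x + y)) (lineGen γ) =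
        V.tmul (toExtPerp p γ x) (lineGen γ) + V.tmul (toExtPerp p γ y) (lineGen γ) :=
      (congrArg (fun x => V.tmul x (lineGen γ)) (map_add (toExtPerp p γ) x y)).trans
        (TensorProduct.add_tmul _ _ _)
    exact h1.trans (congrArg₂ (· + ·) hx hy)

theorem toExtPerp_injective (p : ℕ) (γ : Finset (NR N)) :
    Function.Injective (toExtPerp p γ) := fun x y h => by
  rw [← tmul_toExtPerp x, h, tmul_toExtPerp]

open Classical in
-- The inserted generator evaluates to `1`, provided some functional takes the value `1` at the
-- vertex, so only the contraction survives.
theorem toExtPerp_component {p : ℕ} {μ ν : Finset (NR N)} {v : NR N} (hv : v ∈ ν)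
    (hμ : μ = ν.erase v) (h : ∀ v ∈ ν, ∃ e : MC N, eval v e = 1) (z : V p μ) :
    toExtPerp p ν (component p hv hμ z) = contractPerp p hv hμ (toExtPerp p μ z) := by
  conv_lhs => rw [← tmul_toExtPerp z]
  have hsub : μ ⊆ ν := hμ ▸ Finset.erase_subset v ν
  rw [component_tmul, toExtPerp_tmul, lineEval_insertGen hsub h,
    lineEval_lineGen fun u hu => h u (hsub hu), one_smul]

end Lines

/-! ### Transfer to the Ishida complex -/

section Complex

variable {N : Type*} [AddCommGroup N] {σ : PointedCone ℝ (NR N)} {B : BarycentricChoice σ}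

open Classical in
theorem coe_contractPerp {p : ℕ} {μ ν : Finset (NR N)} {v : NR N} (hv : v ∈ ν)
    (h : μ = ν.erase v) (hp : ν.card ≤ p) (x : extPerp p μ) :
    (contractPerp p hv h x : ExteriorAlgebra ℂ (MC N)) = contract v x := by
  rw [contractPerp, dif_pos hp]
  rfl

theorem coe_toExtPerp_differential {p i : ℕ} (hip : i < p) (x : term B p i)
    (z : Finset (NR N) → ExteriorAlgebra ℂ (MC N))
    (hz : ∀ γ : simplicesOfCard B i, z γ.1 = toExtPerp p γ.1 (x γ))
    (ν : simplicesOfCard B (i + 1)) (h : ∀ v ∈ ν.1, ∃ e : MC N, eval v e = 1) :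
    (toExtPerp p ν.1 (differential B p i x ν) : ExteriorAlgebra ℂ (MC N)) =
      coboundary z ν.1 := by
  classical
  have hp : ν.1.card ≤ p := by rw [ν.2.2]; exact hip
  have hv : ∀ v : ν.1, ((extPerp p ν.1).subtype ∘ₗ toExtPerp p ν.1)
      (component p v.2 (rfl : (facet ν v.2).1 = _) (x (facet ν v.2))) =
        contract v (z (ν.1.erase v)) := by
    intro v
    rw [LinearMap.comp_apply, toExtPerp_component v.2 rfl h, Submodule.subtype_apply,
      coe_contractPerp v.2 rfl hp, hz (facet ν v.2)]
  have hsum := map_sum ((extPerp p ν.1).subtype ∘ₗ toExtPerp p ν.1)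
    (fun v : ν.1 => component p v.2 (rfl : (facet ν v.2).1 = _) (x (facet ν v.2))) Finset.univ
  rw [← differential_apply, Fintype.sum_congr _ _ hv,
    Finset.sum_coe_sort ν.1 fun v => contract v (z (ν.1.erase v))] at hsum
  exact hsum

theorem subsingleton_term {p i : ℕ} (hip : p < i) : Subsingleton (term B p i) := by
  refine ⟨fun x y => funext fun γ => toExtPerp_injective _ _ (Subtype.ext ?_)⟩
  have hbot : extPerp p γ.1 = ⊥ := by rw [extPerp, if_neg (by rw [γ.2.2]; omega)]
  have h0 : ∀ a : extPerp p γ.1, (a : ExteriorAlgebra ℂ (MC N)) = 0 := fun a => by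
    have h1 : (a : ExteriorAlgebra ℂ (MC N)) ∈ (⊥ : Submodule ℂ (ExteriorAlgebra ℂ (MC N))) :=
      hbot.le a.2
    exact (Submodule.mem_bot ℂ).1 h1
  rw [h0, h0]

theorem ishidaComplex_d (p i : ℕ) :
    (ishidaComplex B p).d i (i + 1) = ModuleCat.ofHom (differential B p i) :=
  CochainComplex.of_d (fun i => ModuleCat.of ℂ (term B p i))
    (fun i => ModuleCat.ofHom (differential B p i)) i

open CategoryTheory in
theorem ishidaComplex_exactAt_succ_iff (p i : ℕ) : (ishidaComplex B p).ExactAt (i + 1) ↔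
    ∀ x : term B p (i + 1), differential B p (i + 1) x = 0 → ∃ y, differential B p i y = x := by
  rw [HomologicalComplex.exactAt_iff' _ i (i + 1) (i + 2) (by simp) (by simp),
    ShortComplex.moduleCat_exact_iff]
  dsimp only [HomologicalComplex.shortComplexFunctor', HomologicalComplex.sc']
  rw [ishidaComplex_d, ishidaComplex_d]
  exact Iff.rfl

open CategoryTheory in
theorem ishidaComplex_exactAt_zero (p : ℕ)
    (h : ∀ x : term B p 0, differential B p 0 x = 0 → x = 0) : (ishidaComplex B p).ExactAt 0 := by
  -- The predecessor of degree `0` is by convention `0` itself, with zero differential, so exactness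
  -- is injectivity of the outgoing map.
  rw [HomologicalComplex.exactAt_iff' _ 0 0 1 (by simp) (by simp),
    ShortComplex.moduleCat_exact_iff]
  dsimp only [HomologicalComplex.shortComplexFunctor', HomologicalComplex.sc']
  rw [ishidaComplex_d]
  intro x hx
  have hx0 : x = 0 := h x hx
  exact ⟨0, (map_zero _).trans hx0.symm⟩

variable [Module.Free ℤ N] [Module.Finite ℤ N]

/-- Each vertex of a simplex is nonzero, and the cocycles of degree `i < p` of the Ishida complex
are coboundaries (of nothing if `i = 0`). -/
theorem exists_coboundary_eq (hrational : IsRationalPolyhedral σ) {p i : ℕ} (hip : i < p)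
    (x : term B p i) (hdx : differential B p i x = 0) :
    (∀ γ ∈ simplices B, ∀ v ∈ γ, ∃ e : MC N, eval v e = 1) ∧
    ∃ y : Finset (NR N) → ExteriorAlgebra ℂ (MC N),
      (∀ γ ∈ simplices B, γ.card + 1 = i → y γ ∈ extPerp p γ) ∧
      ∀ ν : simplicesOfCard B i, coboundary y ν.1 = toExtPerp p ν.1 (x ν) := by
  classical
  obtain ⟨S₀, hS₀⟩ := hrational
  obtain ⟨S, hS⟩ : ∃ S : Finset (NR N), σ = PointedCone.hull ℝ (S : Set (NR N)) :=
    ⟨S₀.image fun x => (1 : ℝ) ⊗ₜ[ℤ] x, by rw [hS₀, Finset.coe_image]⟩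
  let 𝓕 : Finset (Finset (NR N)) := (finite_flags S hS).toFinset.image (flagVertices B)
  have h𝓕 : ∀ F, F ∈ 𝓕 ↔ ∃ μ, IsFlag σ μ ∧ flagVertices B μ = F := by
    intro F; simp [𝓕]
  have hsimp : ∀ γ, γ ∈ simplices B ↔ ∃ F ∈ 𝓕, γ ⊆ F := by
    intro γ
    constructor
    · rintro ⟨μ, hμ, hγ⟩
      exact ⟨_, (h𝓕 _).2 ⟨μ, hμ, rfl⟩, fun v hv => mem_flagVertices.2 (hγ hv)⟩
    · rintro ⟨F, hF, hγ⟩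
      obtain ⟨μ, hμ, rfl⟩ := (h𝓕 F).1 hF
      exact ⟨μ, hμ, fun v hv => mem_flagVertices.1 (hγ hv)⟩
  have hcard : ∀ F ∈ 𝓕, F.card = Module.finrank ℝ (NR N) := by
    intro F hF
    obtain ⟨μ, hμ, rfl⟩ := (h𝓕 F).1 hF
    exact hμ.card_flagVertices B S hS
  have hli : ∀ F ∈ 𝓕, LinearIndependent ℝ fun v : F => (v : NR N) := by
    intro F hF
    obtain ⟨μ, hμ, rfl⟩ := (h𝓕 F).1 hF
    exact hμ.linearIndepOn_flagVertices B S hS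
  obtain ⟨h, hh⟩ := exists_height B S hS
  obtain ⟨sh⟩ := nonempty_shelling 𝓕 hcard hli h
    (by
      intro F hF
      obtain ⟨μ, hμ, rfl⟩ := (h𝓕 F).1 hF
      obtain ⟨L, hL, hlt⟩ := hh μ hμ
      refine ⟨L, hL, fun F' hF' => ?_⟩
      obtain ⟨μ', hμ', rfl⟩ := (h𝓕 F').1 hF'
      exact hlt μ' hμ')
    (B.ρ σ)
    (by
      intro F hF
      obtain ⟨μ, hμ, rfl⟩ := (h𝓕 F).1 hF
      exact hμ.apex_mem B S hS)
    (by
      intro F hF v hv hne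
      obtain ⟨μ, hμ, rfl⟩ := (h𝓕 F).1 hF
      obtain ⟨μ', hμ', h1, h2⟩ := hμ.exists_adjacent B S hS hv hne
      exact ⟨_, (h𝓕 _).2 ⟨μ', hμ', rfl⟩, h1, h2⟩)
  have hdual : ∀ F ∈ 𝓕, ∃ e, IsDualBasis F e := fun F hF =>
    exists_isDualBasis (hcard F hF) (hli F hF)
  choose! e he using hdual
  have hnd : ∀ γ ∈ simplices B, ∀ v ∈ γ, ∃ e : MC N, eval v e = 1 := by
    intro γ hγ v hv
    obtain ⟨F, hF, hγF⟩ := (hsimp γ).1 hγ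
    exact ⟨e F v, (he F hF).eval_self v (hγF hv)⟩
  -- Extension by zero to all finite sets; only the values on simplices with `i` vertices matter.
  let z : Finset (NR N) → ExteriorAlgebra ℂ (MC N) := fun γ =>
    if hγ : γ ∈ simplices B ∧ γ.card = i then toExtPerp p γ (x ⟨γ, hγ⟩) else 0
  have hz : ∀ γ : simplicesOfCard B i, z γ.1 = toExtPerp p γ.1 (x γ) := fun γ => dif_pos γ.2
  obtain ⟨y, hy, hyz⟩ := sh.exists_primitive e he hip z
    (fun γ hγ hc => by
      rw [hz ⟨γ, (hsimp γ).2 hγ, hc⟩]; exact Subtype.coe_prop _)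
    (fun ν hν hc => by
      have h1 := coe_toExtPerp_differential hip x z hz ⟨ν, (hsimp ν).2 hν, hc⟩
        (hnd ν ((hsimp ν).2 hν))
      rw [← h1, hdx, Pi.zero_apply, map_zero, Submodule.coe_zero])
  refine ⟨hnd, y, fun γ hγ hc => hy γ ((hsimp γ).1 hγ) hc, fun ν => ?_⟩
  rw [hyz ν.1 ((hsimp _).1 ν.2.1) ν.2.2, hz]

end Complex

end ToricIshida
end

/-- Let `σ ⊆ N_ℝ` be a full-dimensional strongly convex rational polyhedral cone and `B` the choices
that define a barycentric subdivision of `σ`. For every `p`, the degree-`0` part of the pushforward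
of the Ishida complex is exact in all cohomological degrees other than `p`. -/
theorem proposition3p2 {N : Type*} [AddCommGroup N] [Module.Free ℤ N] [Module.Finite ℤ N]
    (σ : PointedCone ℝ (ToricIshida.NR N))
    (hrational : ToricIshida.IsRationalPolyhedral σ)
    (hconvex : (σ : ConvexCone ℝ (ToricIshida.NR N)).Salient)
    (hfull : Submodule.span ℝ (σ : Set (ToricIshida.NR N)) = ⊤)
    (B : ToricIshida.BarycentricChoice σ) (p i : ℕ) (hi : i ≠ p) :
    (ToricIshida.ishidaComplex B p).ExactAt i := by
  open ToricIshida in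
  cases i with
  | zero =>
    refine ishidaComplex_exactAt_zero p fun x hx => funext fun ν => toExtPerp_injective _ _ ?_
    obtain ⟨-, y, -, hy⟩ := exists_coboundary_eq hrational (Nat.pos_of_ne_zero hi.symm) x hx
    -- In degree `0` the simplex is empty, so the coboundary is an empty sum and the cocycle
    -- vanishes.
    have h0 : coboundary y ν.1 = 0 := by
      rw [Finset.card_eq_zero.1 ν.2.2, coboundary, Finset.sum_empty]
    rw [Pi.zero_apply, map_zero]
    exact Subtype.ext ((hy ν).symm.trans h0)
  | succ i =>
    rw [ishidaComplex_exactAt_succ_iff]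
    intro x hx
    rcases lt_or_gt_of_ne hi with hip | hip
    · obtain ⟨hnd, y, hymem, hy⟩ := exists_coboundary_eq hrational hip x hx
      refine ⟨fun γ => V.tmul ⟨y γ.1, hymem γ.1 γ.2.1 (by rw [γ.2.2])⟩ (lineGen γ.1),
        funext fun ν => toExtPerp_injective _ _ (Subtype.ext ?_)⟩
      rw [coe_toExtPerp_differential (by omega) _ y (fun γ => ?_) ν (hnd ν.1 ν.2.1), hy]
      rw [toExtPerp_tmul, lineEval_lineGen (hnd γ.1 γ.2.1), one_smul]
    · have := subsingleton_term (B := B) hip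
      exact ⟨0, Subsingleton.elim _ _⟩
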